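/- **Conventions.** Manifolds are smooth, connected, non-empty and without boundary; metrics and foliations are smooth. A compact Riemannian manifold $(M,g)$ carries its Riemannian distance, and $d_{\rm GH}$ is the Gromov–Hausdorff distance. For a metric space $X$ and $r>0$ let $\mathrm{Cap}_r(X)$ be the largest number of pairwise disjoint open balls of radius $r$ in $X$. A metric space $X'$ is *broader* than $X$, written $X'\succeq X$, if $\mathrm{Cap}_\delta(X')\ge \mathrm{Cap}_\delta(X)$ for all $\delta>0$. A foliation is *compact Hausdorff* if all its leaves are compact and its space of leaves $M/\mathcal F$, with the quotient topology, is Hausdorff. A leaf $L$ carries the distance and the volume of the Riemannian metric induced by $g$, and $B_L(x,\epsilon)$ denotes a ball for this distance. The space of leaves carries $$\rho(L,L')=\inf\Big\{\sum_{i=1}^{m-1}\mathrm{dist}(L_i,L_{i+1}) : L_1=L,\ L_m=L'\Big\},$$ the infimum over all finite sequences of leaves, where $\mathrm{dist}(L_i,L_{i+1})=\inf\{d(x,y):x\in L_i,\ y\in L_{i+1}\}$. A foliation is *Riemannian* for a metric $\tilde g$ if $\tilde g$ is bundle-like, i.e. locally the restriction of $\tilde g$ to the orthogonal complement of the leaves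 is the pull-back of a metric on the local space of leaves. **The class $\mathcal M(d,C,p,n)$.** For $d>0$, $C\ge 1$ it consists of all compact $n$-dimensional Riemannian manifolds with a compact Hausdorff foliation of dimension $p$, $(M,\mathcal F,g)$, such that 1. for every leaf $L$, all $x,y\in L$ and every $\epsilon<d$: if $B_L(x,\epsilon)$ and $B_L(y,\epsilon)$ are disjoint in $L$, then $B(x,\epsilon)$ and $B(y,\epsilon)$ are disjoint in $M$; 2. for every leaf $L$ there are constants $1\le C_L\le C$ and $\theta_L\ge 1/C$ with $$\frac{1}{C_L r^p}\,\mathrm{vol}(L)\le \mathrm{Cap}_r(L)\le \frac{C_L}{r^p}\,\mathrm{vol}(L)\qquad(0<r<\theta_L),$$ and there are constants $1\le C_M\le C$ and $\theta_M\ge 1/C$ with $$\frac{1}{C_M r^n}\,\mathrm{vol}(M)\le \mathrm{Cap}_r(M)\le \frac{C_M}{r^n}\,\mathrm{vol}(M)\qquad(0<r<\theta_M);$$ 3. $\frac1C\le \mathrm{vol}(L)\le C$ for every leaf $L$; 4. there is a Riemannian metric $\tilde g$ on $M$ with $\frac1C g\le\tilde g\le Cg$ for which $\mathcal F$ is a Riemannian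 foliation. **Theorem (GH-separation Theorem).** Let $d>0$, $C\ge1$, and let $p,p',n,n'$ be natural numbers with $p'>p$ and $n'\ge n$. There is $\epsilon>0$ such that for all $(M,\mathcal F,g)\in\mathcal M(d,C,p,n)$ and $(M',\mathcal F',g')\in\mathcal M(d,C,p',n')$ with $(M'/\mathcal F',\rho')\succeq(M/\mathcal F,\rho)$, $$d_{\rm GH}(M,M')>\epsilon .$$ -/

import Mathlib

open scoped Manifold ContDiff Topology ENNReal
open Bundle

noncomputable section

/-! ### Balls and capacity -/

/-- The open ball of radius `r` around `x` for a distance function `e`. -/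
def eBall {X : Type*} (e : X → X → ℝ≥0∞) (x : X) (r : ℝ) : Set X :=
  {y | e x y < ENNReal.ofReal r}

/-- The capacity `Cap_r(X)`: the largest number of pairwise disjoint open `r`-balls in `(X, e)`.
The finite set `s` is the set of centres. -/
def capacity {X : Type*} (e : X → X → ℝ≥0∞) (r : ℝ) : ℕ∞ :=
  ⨆ (s : Finset X) (_ : (s : Set X).PairwiseDisjoint fun x => eBall e x r), (s.card : ℕ∞)

/-- `(X', e')` is broader than `(X, e)`: its capacity is at least as large at every scale. -/
def Broader {X' X : Type*} (e' : X' → X' → ℝ≥0∞) (e : X → X → ℝ≥0∞) : Prop :=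
  ∀ δ : ℝ, 0 < δ → capacity e δ ≤ capacity e' δ

/-- The two-sided capacity estimate in dimension `k` for a space `(X, e)` of total volume `V`,
with constants `c` and `θ`: for `0 < r < θ`,
`V / (c r ^ k) ≤ Cap_r(X) ≤ c V / r ^ k`. -/
def CapacityEstimate {X : Type*} (e : X → X → ℝ≥0∞) (k : ℕ) (V : ℝ≥0∞) (c θ : ℝ) : Prop :=
  ∀ r : ℝ, 0 < r → r < θ →
    ENNReal.ofReal (1 / (c * r ^ k)) * V ≤ (capacity e r : ℝ≥0∞) ∧
      (capacity e r : ℝ≥0∞) ≤ ENNReal.ofReal (c / r ^ k) * V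

/-! ### Foliations -/

/-- The Euclidean space `ℝ ^ k`. -/
abbrev Euc (k : ℕ) : Type := EuclideanSpace ℝ (Fin k)

/-- A smooth foliation of dimension `p` on an `n`-dimensional smooth manifold `M`, given by a
foliated atlas: smooth charts with values in `ℝ ^ p × ℝ ^ (n - p)` that cover `M`, such that every
change of charts is locally of the form `(u, y) ↦ (a (u, y), b y)`.
(A nonempty `M` has such charts only if `p ≤ n`, so `n - p` is never truncated.) -/
structure Foliation (p n : ℕ) (M : Type*) [TopologicalSpace M] [ChartedSpace (Euc n) M] where
  /-- The foliated charts. -/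
  charts : Set (OpenPartialHomeomorph M (Euc p × Euc (n - p)))
  contMDiffOn : ∀ φ ∈ charts, ContMDiffOn (𝓡 n) 𝓘(ℝ, Euc p × Euc (n - p)) ∞ φ φ.source
  contMDiffOn_symm : ∀ φ ∈ charts,
    ContMDiffOn 𝓘(ℝ, Euc p × Euc (n - p)) (𝓡 n) ∞ φ.symm φ.target
  cover : ∀ x : M, ∃ φ ∈ charts, x ∈ φ.source
  compatible : ∀ φ ∈ charts, ∀ ψ ∈ charts, ∀ x ∈ φ.source ∩ ψ.source, ∃ U ∈ 𝓝 x,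
    ∀ z ∈ U, ∀ w ∈ U, (φ z).2 = (φ w).2 → (ψ z).2 = (ψ w).2

namespace Foliation

section Topological

variable {p n : ℕ} {M : Type*} [TopologicalSpace M] [ChartedSpace (Euc n) M]

/-- The leaf topology on `M`, generated by the open pieces `{z ∈ V | (φ z).2 = c}` of the slices
of foliated charts `φ`. -/
@[reducible] def leafTopology (F : Foliation p n M) : TopologicalSpace M :=
  TopologicalSpace.generateFrom
    {s | ∃ φ ∈ F.charts, ∃ V : Set M, IsOpen V ∧ ∃ c : Euc (n - p),
      s = {z | z ∈ φ.source ∧ z ∈ V ∧ (φ z).2 = c}}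

/-- The leaf through `x`: the connected component of `x` for the leaf topology. -/
def leaf (F : Foliation p n M) (x : M) : Set M :=
  @connectedComponent M F.leafTopology x

/-- The equivalence relation "to lie on the same leaf". -/
def leafSetoid (F : Foliation p n M) : Setoid M :=
  @connectedComponentSetoid M F.leafTopology

/-- The space of leaves `M / F`; as a quotient type of `M`, it carries the quotient of the manifold
topology of `M`. -/
abbrev LeafSpace (F : Foliation p n M) : Type _ :=
  Quotient F.leafSetoid

/-- Every leaf is compact (for the leaf topology) and the space of leaves is Hausdorff. -/
structure IsCompactHausdorff (F : Foliation p n M) : Prop where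
  isCompact_leaf : ∀ x : M, @IsCompact M F.leafTopology (F.leaf x)
  t2 : T2Space F.LeafSpace

/-- The transverse coordinate of a foliated chart. -/
def transverse (φ : OpenPartialHomeomorph M (Euc p × Euc (n - p))) (z : M) : Euc (n - p) :=
  (φ z).2

/-- The derivative at `z` of the transverse coordinate of a foliated chart. -/
def dTransverse (φ : OpenPartialHomeomorph M (Euc p × Euc (n - p))) (z : M)
    (v : TangentSpace (𝓡 n) z) : Euc (n - p) :=
  mfderiv (𝓡 n) 𝓘(ℝ, Euc (n - p)) (transverse φ) z v

/-- The tangent vectors at `z` that are tangent to the leaf through `z`. -/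
def tangent (F : Foliation p n M) (z : M) : Set (TangentSpace (𝓡 n) z) :=
  {v | ∀ φ ∈ F.charts, z ∈ φ.source → dTransverse φ z v = 0}

end Topological

section Metric

variable {p n : ℕ} {M : Type*} [TopologicalSpace M] [ChartedSpace (Euc n) M]
  [IsManifold (𝓡 n) ∞ M]

/-- The foliation is Riemannian for the metric `g`, i.e. `g` is bundle-like: near every point there
are a foliated chart and a transverse metric `h`, which depends on the transverse coordinate only,
such that for vectors `v`, `w` orthogonal to the leaves `g (v, w)` is the `h`-product of the
transverse components of `v` and `w`. -/
def IsRiemannian (F : Foliation p n M)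
    (g : ContMDiffRiemannianMetric (𝓡 n) ∞ (Euc n) (fun x : M => TangentSpace (𝓡 n) x)) : Prop :=
  ∀ x : M, ∃ φ ∈ F.charts, x ∈ φ.source ∧ ∃ U ∈ 𝓝 x,
    ∃ h : Euc (n - p) → (Euc (n - p) →L[ℝ] Euc (n - p) →L[ℝ] ℝ),
      ∀ z ∈ U, ∀ v w : TangentSpace (𝓡 n) z,
        (∀ u ∈ F.tangent z, g.inner z v u = 0) → (∀ u ∈ F.tangent z, g.inner z w u = 0) →
          g.inner z v w = h (transverse φ z) (dTransverse φ z v) (dTransverse φ z w)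

end Metric

end Foliation

/-! ### Riemannian volume -/

section Volume

variable {n : ℕ} {M : Type*} [TopologicalSpace M] [ChartedSpace (Euc n) M]
  [RiemannianBundle (fun x : M => TangentSpace (𝓡 n) x)]

/-- The volume `∫_D √(det (g (∂ᵢσ, ∂ⱼσ)))` of the piece of `M` parametrised by `σ` on `D ⊆ ℝ ^ k`,
for the induced Riemannian metric. -/
def paramVolume {k : ℕ} (σ : Euc k → M) (D : Set (Euc k)) : ℝ≥0∞ :=
  ∫⁻ u in D, ENNReal.ofReal (Real.sqrt (Matrix.det (Matrix.of fun i j : Fin k =>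
    inner ℝ (mfderiv 𝓘(ℝ, Euc k) (𝓡 n) σ u (EuclideanSpace.single i (1 : ℝ)))
      (mfderiv 𝓘(ℝ, Euc k) (𝓡 n) σ u (EuclideanSpace.single j (1 : ℝ))))))

/-- The volume of `A` computed with the family `P` of coordinate patches `(σ, D)`: the infimum, over
all countable covers of `A` by patches, of the total volume of the patches. (Where the patches are
measurable pieces of coordinate systems of a manifold, the infimum is attained by cutting the
manifold into countably many disjoint patches, and it is the Riemannian volume.) -/
def patchVolume {k : ℕ} (P : Set ((Euc k → M) × Set (Euc k))) (A : Set M) : ℝ≥0∞ :=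
  ⨅ (s : ℕ → P) (_ : A ⊆ ⋃ i, (s i).1.1 '' (s i).1.2),
    ∑' i, paramVolume (n := n) (s i).1.1 (s i).1.2

variable (n M) in
/-- The volume of the Riemannian manifold `M`, computed in its charts. -/
def manifoldVolume : ℝ≥0∞ :=
  patchVolume (n := n) {P : (Euc n → M) × Set (Euc n) | ∃ x : M,
    P.1 = (chartAt (Euc n) x).symm ∧ MeasurableSet P.2 ∧ P.2 ⊆ (chartAt (Euc n) x).target}
    Set.univ

/-- The volume of the leaf through `x` for the induced Riemannian metric, computed with the
coordinates `u ↦ φ⁻¹ (u, c)` that the foliated charts give on the leaves. -/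
def Foliation.leafVolume {p : ℕ} (F : Foliation p n M) (x : M) : ℝ≥0∞ :=
  patchVolume (n := n) {P : (Euc p → M) × Set (Euc p) | ∃ φ ∈ F.charts, ∃ c : Euc (n - p),
    P.1 = (fun u => φ.symm (u, c)) ∧ MeasurableSet P.2 ∧
      (∀ u ∈ P.2, (u, c) ∈ φ.target ∧ φ.symm (u, c) ∈ F.leaf x)}
    (F.leaf x)

/-- The distance of two points on a leaf for the induced Riemannian metric: the infimum of the
lengths of the `C¹` curves on the leaf that join them. -/
def Foliation.leafEDist {p : ℕ} (F : Foliation p n M) (x y : M) : ℝ≥0∞ :=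
  ⨅ (γ : ℝ → M) (_ : ContMDiffOn 𝓘(ℝ, ℝ) (𝓡 n) 1 γ (Set.Icc 0 1)) (_ : γ 0 = x) (_ : γ 1 = y)
    (_ : ∀ t ∈ Set.Icc (0 : ℝ) 1, γ t ∈ F.leaf x), Manifold.pathELength (𝓡 n) γ 0 1

/-- `leafEDist` on the points of the leaf through `x`. -/
def Foliation.edistOnLeaf {p : ℕ} (F : Foliation p n M) (x : M) (a b : F.leaf x) : ℝ≥0∞ :=
  F.leafEDist a b

end Volume

/-! ### The metric on the space of leaves -/

section LeafSpaceMetric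

variable {p n : ℕ} {M : Type*} [PseudoEMetricSpace M] [ChartedSpace (Euc n) M]

/-- `dist (L, L')`, the infimum of the distances between points of `L` and points of `L'`. -/
def Foliation.setDist (F : Foliation p n M) (L L' : F.LeafSpace) : ℝ≥0∞ :=
  ⨅ (x : M) (y : M) (_ : (⟦x⟧ : F.LeafSpace) = L) (_ : (⟦y⟧ : F.LeafSpace) = L'), edist x y

/-- The metric `ρ (L, L')`: the infimum of `∑ dist (Lᵢ, Lᵢ₊₁)` over all finite sequences of leaves
from `L` to `L'`. -/
def Foliation.rho (F : Foliation p n M) (L L' : F.LeafSpace) : ℝ≥0∞ :=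
  ⨅ (m : ℕ) (S : ℕ → F.LeafSpace) (_ : S 0 = L) (_ : S m = L'),
    ∑ i ∈ Finset.range m, F.setDist (S i) (S (i + 1))

end LeafSpaceMetric

/-! ### The class of foliated Riemannian manifolds -/

/-- The class `𝓜(d, C, p, n)`: `(M, F, g)` with `M` a compact `n`-dimensional Riemannian manifold
and `F` a compact Hausdorff foliation of dimension `p` satisfying the uniform bounds below. -/
structure Foliation.InClass {p n : ℕ} {M : Type*} [MetricSpace M] [ChartedSpace (Euc n) M]
    [IsManifold (𝓡 n) ∞ M] [RiemannianBundle (fun x : M => TangentSpace (𝓡 n) x)]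
    (F : Foliation p n M) (d C : ℝ) : Prop where
  isCompactHausdorff : F.IsCompactHausdorff
  /-- Balls of radius less than `d` that are disjoint in a leaf are disjoint in `M`. -/
  disjoint_balls : ∀ x : M, ∀ a b : F.leaf x, ∀ ε : ℝ, ε < d →
    Disjoint (eBall (F.edistOnLeaf x) a ε) (eBall (F.edistOnLeaf x) b ε) →
      Disjoint (eBall edist (a : M) ε) (eBall edist (b : M) ε)
  /-- The capacity estimate for the leaves, with uniform constants. -/
  leaf_capacity : ∀ x : M, ∃ c θ : ℝ, 1 ≤ c ∧ c ≤ C ∧ 1 / C ≤ θ ∧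
    CapacityEstimate (F.edistOnLeaf x) p (F.leafVolume x) c θ
  /-- The capacity estimate for `M`, with uniform constants. -/
  capacity : ∃ c θ : ℝ, 1 ≤ c ∧ c ≤ C ∧ 1 / C ≤ θ ∧
    CapacityEstimate (fun x y : M => edist x y) n (manifoldVolume n M) c θ
  leaf_volume : ∀ x : M,
    ENNReal.ofReal (1 / C) ≤ F.leafVolume x ∧ F.leafVolume x ≤ ENNReal.ofReal C
  /-- A comparable metric for which the foliation is Riemannian. -/
  exists_riemannian :
    ∃ g : ContMDiffRiemannianMetric (𝓡 n) ∞ (Euc n) (fun x : M => TangentSpace (𝓡 n) x),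
      (∀ (x : M) (v : TangentSpace (𝓡 n) x),
        1 / C * inner ℝ v v ≤ g.inner x v v ∧ g.inner x v v ≤ C * inner ℝ v v) ∧
      F.IsRiemannian g

end

/-! Count disjoint balls at one small scale `r`. Put `N = Cap_r(M/F)`. In `M'`, choose `N` leaves
with disjoint `ρ'`-balls, which exist because `M'/F'` is broader, and on each of them about `r ^
(-p')` disjoint leaf balls. The balls of radius `r` in `M'` around all these centres are disjoint:
on one leaf by the first axiom of the class, on different leaves because `M' → M'/F'` is
1-Lipschitz. So `Cap_r(M')` is at least of order `N r ^ (-p')` (`mul_le_capacity`).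

In `M`, conversely, maximal families of disjoint balls in the space of leaves and on the leaves give
a cover by at most `N r ^ (-p)` balls, up to a constant, of radius `6 C r`
(`IsComparablyRiemannian.capacity_le_mul`). If `d_GH(M, M') ≤ r`, then `Cap_{24 C r}(M') ≤ Cap_{6 C
r}(M)`, and the capacity estimate of `M'` compares the scales `24 C r` and `r`. The factor `N`
cancels and `r ^ p ≤ D r ^ p'` remains, with `D` depending only on `C` and `n'`. This is false for
small `r`, as `p < p'`.

The geometric input is in the upper bound: if `ρ(L, L') < s`, then every point of `L`, and not just
some point, is within `2 C s` of `L'`. To prove it, a short curve issuing from `L` is moved along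
the plaques of `L`. For the bundle-like metric the orthogonal part of its velocity is controlled by
transverse data alone, so a bound on that part survives any number of moves unchanged. The length of
each moved curve is estimated from this bound afresh, with a fixed factor, and no error accumulates
however many plaques are crossed. The moves use affine lifts in charts, so no horizontal lift has to
be integrated. -/

noncomputable section

namespace Foliation

/-! ### Plaques, leaves and saturated sets. -/

section LeafTopology

variable {p n : ℕ} {M : Type*} [TopologicalSpace M] [ChartedSpace (Euc n) M]

/-- The plaques of foliated charts are open in the leaf topology. -/
theorem isOpen_plaque (F : Foliation p n M) {φ : OpenPartialHomeomorph M (Euc p × Euc (n - p))}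
    (hφ : φ ∈ F.charts) {V : Set M} (hV : IsOpen V) (c : Euc (n - p)) :
    IsOpen[F.leafTopology] {z | z ∈ φ.source ∧ z ∈ V ∧ (φ z).2 = c} :=
  TopologicalSpace.isOpen_generateFrom_of_mem ⟨φ, hφ, V, hV, c, rfl⟩

theorem mem_leaf_self (F : Foliation p n M) (x : M) : x ∈ F.leaf x :=
  @mem_connectedComponent M F.leafTopology x

theorem leaf_eq_of_mem (F : Foliation p n M) {x y : M} (h : y ∈ F.leaf x) :
    F.leaf x = F.leaf y :=
  @connectedComponent_eq M F.leafTopology x y h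

theorem mk_eq_mk_iff (F : Foliation p n M) {x y : M} :
    (⟦x⟧ : F.LeafSpace) = ⟦y⟧ ↔ F.leaf x = F.leaf y :=
  Quotient.eq

theorem mk_eq_mk_iff_mem (F : Foliation p n M) {x y : M} :
    (⟦x⟧ : F.LeafSpace) = ⟦y⟧ ↔ y ∈ F.leaf x := by
  rw [mk_eq_mk_iff]
  exact ⟨fun h => h ▸ F.mem_leaf_self y, fun h => F.leaf_eq_of_mem h⟩

/-- Slices of a foliated chart are continuous for the leaf topology. -/
theorem continuousOn_slice (F : Foliation p n M)
    {φ : OpenPartialHomeomorph M (Euc p × Euc (n - p))}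
    (hφ : φ ∈ F.charts) (c : Euc (n - p)) {s : Set (Euc p)} (hs : ∀ u ∈ s, (u, c) ∈ φ.target) :
    @ContinuousOn _ _ _ F.leafTopology (fun u : Euc p => φ.symm (u, c)) s := by
  refine (@continuousOn_iff_continuous_domRestrict _ _ _ F.leafTopology _ _).2 ?_
  refine continuous_generateFrom_iff.2 ?_
  rintro _ ⟨ψ, hψ, V, hV, c', rfl⟩
  rw [isOpen_iff_mem_nhds]
  rintro ⟨u, hu⟩ ⟨h1, h2, h3⟩
  simp only [Set.domRestrict_apply] at h1 h2 h3
  have hu' := hs u hu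
  -- Near `u` the slice of `φ` stays inside a single slice of `ψ`, so the preimage of a generating
  -- plaque is open.
  obtain ⟨U, hU, hUc⟩ := F.compatible φ hφ ψ hψ (φ.symm (u, c)) ⟨φ.map_target hu', h1⟩
  have hcont : ContinuousAt (fun w : s => φ.symm ((w : Euc p), c)) ⟨u, hu⟩ :=
    ContinuousAt.comp_of_eq (f := fun w : s => ((w : Euc p), c)) (φ.continuousAt_symm hu')
      (by fun_prop) rfl
  have hev := hcont.eventually (Filter.inter_mem hU (Filter.inter_mem (ψ.open_source.mem_nhds h1)
    (hV.mem_nhds h2)))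
  filter_upwards [hev] with w hw
  refine ⟨hw.2.1, hw.2.2, ?_⟩
  rw [← h3]
  refine hUc _ hw.1 _ (mem_of_mem_nhds hU) ?_
  rw [φ.right_inv (hs w w.2), φ.right_inv hu']

/-- Two points with the same transverse coordinate in a box of a foliated chart lie on
the same leaf. -/
theorem mem_leaf_of_mem_ball (F : Foliation p n M)
    {φ : OpenPartialHomeomorph M (Euc p × Euc (n - p))} (hφ : φ ∈ F.charts)
    {y : Euc p × Euc (n - p)} {η : ℝ} (hη : Metric.ball y η ⊆ φ.target) {z w : M}
    (hz : z ∈ φ.source) (hw : w ∈ φ.source) (hzy : φ z ∈ Metric.ball y η)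
    (hwy : φ w ∈ Metric.ball y η) (h : (φ z).2 = (φ w).2) : w ∈ F.leaf z := by
  -- With the sup norm a ball of the product is a box, so its slices are convex and their images are
  -- connected in the leaf topology.
  rw [← ball_prod_same] at hη hzy hwy
  have hc := F.continuousOn_slice hφ (φ z).2 (s := Metric.ball y.1 η)
    (fun u hu => hη ⟨hu, hzy.2⟩)
  have hpre := @IsPreconnected.image _ _ _ F.leafTopology _
    (convex_ball y.1 η).isPreconnected _ hc
  refine @IsPreconnected.subset_connectedComponent _ F.leafTopology _ _ hpre ?_ _ ?_
  · exact ⟨(φ z).1, hzy.1, φ.left_inv hz⟩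
  · exact ⟨(φ w).1, hwy.1, by simp only [h]; exact φ.left_inv hw⟩

/-- A set that is locally a union of plaques is saturated. -/
theorem leaf_subset_of_plaque_invariant (F : Foliation p n M) (S : Set M)
    (hS : ∀ x : M, ∃ φ ∈ F.charts, ∃ V : Set M, IsOpen V ∧ x ∈ V ∧ V ⊆ φ.source ∧
      ∀ z ∈ V, ∀ w ∈ V, (φ z).2 = (φ w).2 → z ∈ S → w ∈ S) {x : M} (hx : x ∈ S) :
    F.leaf x ⊆ S := by
  have key : ∀ x : M, ∃ N, IsOpen[F.leafTopology] N ∧ x ∈ N ∧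
      ∀ z ∈ N, ∀ w ∈ N, z ∈ S → w ∈ S := by
    intro x
    obtain ⟨φ, hφ, V, hV, hxV, hVs, h⟩ := hS x
    refine ⟨_, F.isOpen_plaque hφ hV (φ x).2, ⟨hVs hxV, hxV, rfl⟩, ?_⟩
    rintro z ⟨_, hz, hz'⟩ w ⟨_, hw, hw'⟩
    exact h z hz w hw (hz'.trans hw'.symm)
  -- The invariance can be read in both directions, so `S` and its complement are both unions of
  -- open plaques.
  have hclopen : @IsClopen M F.leafTopology S := by
    refine ⟨(@isOpen_compl_iff M S F.leafTopology).1
      ((@isOpen_iff_forall_mem_open _ F.leafTopology _).2 fun z hz => ?_),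
      (@isOpen_iff_forall_mem_open _ F.leafTopology _).2 fun z hz => ?_⟩
    · obtain ⟨N, hN, hzN, h⟩ := key z
      exact ⟨N, fun w hw hwS => hz (h w hw z hzN hwS), hN, hzN⟩
    · obtain ⟨N, hN, hzN, h⟩ := key z
      exact ⟨N, fun w hw => h z hzN w hw hz, hN, hzN⟩
  exact @IsClopen.connectedComponent_subset _ F.leafTopology _ _ hclopen hx

end LeafTopology

end Foliation

/-! ### Orthogonal lifts for a positive definite form on a product -/

section OrthogonalLift

variable {P Q : Type*} [AddCommGroup P] [Module ℝ P] [AddCommGroup Q] [Module ℝ Q]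

/-- A positive definite form on `P × Q` admits a linear lift `b ↦ (A b, b)` of `Q` that is
orthogonal to `P`. -/
theorem exists_orthogonal_lift [FiniteDimensional ℝ P]
    (B : (P × Q) →ₗ[ℝ] (P × Q) →ₗ[ℝ] ℝ) (hB : ∀ e, e ≠ 0 → 0 < B e e) :
    ∃ A : Q →ₗ[ℝ] P, ∀ b a, B (A b, b) (a, 0) = 0 := by
  let f : P →ₗ[ℝ] Module.Dual ℝ P := B.compl₁₂ (LinearMap.inl ℝ P Q) (LinearMap.inl ℝ P Q)
  let k : Q →ₗ[ℝ] Module.Dual ℝ P := B.compl₁₂ (LinearMap.inr ℝ P Q) (LinearMap.inl ℝ P Q)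
  have hf : Function.Injective f := by
    refine (injective_iff_map_eq_zero f).2 fun a ha => ?_
    by_contra hne
    have h1 : f a a = 0 := by rw [ha]; rfl
    have h2 := hB (a, 0) (by simpa [Prod.ext_iff] using hne)
    simp only [f, LinearMap.compl₁₂_apply, LinearMap.inl_apply] at h1
    exact h2.ne' h1
  let e := LinearMap.linearEquivOfInjective f hf Subspace.dual_finrank_eq.symm
  -- The `P`-block `f` of a positive definite form is invertible, and orthogonality to `P` reads `f
  -- (A b) + k b = 0`.
  refine ⟨-(e.symm.toLinearMap ∘ₗ k), fun b a => ?_⟩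
  have h1 : f (e.symm (k b)) = k b := e.apply_symm_apply (k b)
  have h2 : f (e.symm (k b)) a = k b a := by rw [h1]
  have h3 : ((-(e.symm.toLinearMap ∘ₗ k)) b, b) = (0, b) - ((e.symm (k b), 0) : P × Q) := by
    ext <;> simp
  simp only [f, k, LinearMap.compl₁₂_apply, LinearMap.inl_apply, LinearMap.inr_apply] at h2
  rw [h3, map_sub, LinearMap.sub_apply, sub_eq_zero]
  exact h2.symm

/-- The orthogonal lift is the shortest one. -/
theorem orthogonal_lift_le (B : (P × Q) →ₗ[ℝ] (P × Q) →ₗ[ℝ] ℝ) (hs : ∀ e f, B e f = B f e)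
    (hB : ∀ e, e ≠ 0 → 0 < B e e) {a : P} {b : Q} (h : ∀ a', B (a, b) (a', 0) = 0) (a₁ : P) :
    B (a, b) (a, b) ≤ B (a₁, b) (a₁, b) := by
  have h1 : ((a₁, b) : P × Q) = (a, b) + (a₁ - a, 0) := by ext <;> simp
  have h2 := h (a₁ - a)
  have h3 : 0 ≤ B (a₁ - a, 0) (a₁ - a, 0) := by
    by_cases hz : ((a₁ - a, 0) : P × Q) = 0
    · rw [hz]; simp
    · exact (hB _ hz).le
  rw [h1]
  simp only [map_add, LinearMap.add_apply]
  rw [hs (a₁ - a, 0) (a, b), h2]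
  linarith

end OrthogonalLift

namespace Foliation

/-! ### Derivatives of foliated charts and vectors tangent to the leaves. -/

section Derivatives

variable {p n : ℕ} {M : Type*} [TopologicalSpace M] [ChartedSpace (Euc n) M]
  {φ : OpenPartialHomeomorph M (Euc p × Euc (n - p))}

theorem mdifferentiable_of_mem_charts (F : Foliation p n M) (hφ : φ ∈ F.charts) :
    φ.MDifferentiable (𝓡 n) 𝓘(ℝ, Euc p × Euc (n - p)) :=
  ⟨(F.contMDiffOn φ hφ).mdifferentiableOn (by simp),
    (F.contMDiffOn_symm φ hφ).mdifferentiableOn (by simp)⟩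

theorem hasMFDerivAt_transverse (hd : φ.MDifferentiable (𝓡 n) 𝓘(ℝ, Euc p × Euc (n - p)))
    {z : M} (hz : z ∈ φ.source) :
    HasMFDerivAt (𝓡 n) 𝓘(ℝ, Euc (n - p)) (transverse φ) z
      ((ContinuousLinearMap.snd ℝ (Euc p) (Euc (n - p))).comp
        (mfderiv (𝓡 n) 𝓘(ℝ, Euc p × Euc (n - p)) φ z)) :=
  ((ContinuousLinearMap.snd ℝ (Euc p) (Euc (n - p))).hasMFDerivAt).comp z
    (hd.mdifferentiableAt hz).hasMFDerivAt

theorem dTransverse_eq (hd : φ.MDifferentiable (𝓡 n) 𝓘(ℝ, Euc p × Euc (n - p)))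
    {z : M} (hz : z ∈ φ.source) (v : TangentSpace (𝓡 n) z) :
    dTransverse φ z v =
      Prod.snd (mfderiv (𝓡 n) 𝓘(ℝ, Euc p × Euc (n - p)) φ z v : Euc p × Euc (n - p)) := by
  rw [dTransverse, (hasMFDerivAt_transverse hd hz).mfderiv]
  rfl

theorem dTransverse_mfderiv_symm (hd : φ.MDifferentiable (𝓡 n) 𝓘(ℝ, Euc p × Euc (n - p)))
    {y : Euc p × Euc (n - p)} (hy : y ∈ φ.target) (e : Euc p × Euc (n - p)) :
    dTransverse φ (φ.symm y) (mfderiv 𝓘(ℝ, Euc p × Euc (n - p)) (𝓡 n) φ.symm y e) = e.2 := by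
  rw [dTransverse_eq hd (φ.map_target hy)]
  exact congrArg Prod.snd (DFunLike.congr_fun (hd.comp_symm_deriv hy) e)

/-- One chart suffices to detect the vectors tangent to the leaves. -/
theorem mem_tangent_symm_iff (F : Foliation p n M) (hφ : φ ∈ F.charts)
    {y : Euc p × Euc (n - p)} (hy : y ∈ φ.target) (e : Euc p × Euc (n - p)) :
    mfderiv 𝓘(ℝ, Euc p × Euc (n - p)) (𝓡 n) φ.symm y e ∈ F.tangent (φ.symm y) ↔ e.2 = 0 := by
  have hd := F.mdifferentiable_of_mem_charts hφ
  refine ⟨fun h => ?_, fun h ψ hψ hz => ?_⟩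
  · rw [← dTransverse_mfderiv_symm hd hy e]
    exact h φ hφ (φ.map_target hy)
  have hdψ := F.mdifferentiable_of_mem_charts hψ
  obtain ⟨U, hU, hUc⟩ := F.compatible φ hφ ψ hψ (φ.symm y) ⟨φ.map_target hy, hz⟩
  have h1 := (hasMFDerivAt_transverse hdψ hz).comp y (hd.mdifferentiableAt_symm hy).hasMFDerivAt
  have h2 : HasFDerivAt (transverse ψ ∘ φ.symm) _ y := hasMFDerivAt_iff_hasFDerivAt.1 h1
  have hl : HasDerivAt (fun t : ℝ => y + t • e) e 0 := by
    simpa using ((hasDerivAt_id (0 : ℝ)).smul_const e).const_add y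
  have h3 := HasFDerivAt.comp_hasDerivAt_of_eq (0 : ℝ) h2 hl (by simp)
  -- As `e` has no transverse part, the line stays in one slice of `φ`, hence locally in one slice
  -- of `ψ`; its derivative there vanishes.
  have h4 : (transverse ψ ∘ φ.symm) ∘ (fun t : ℝ => y + t • e) =ᶠ[𝓝 0]
      fun _ => (ψ (φ.symm y)).2 := by
    have hc : ContinuousAt (fun t : ℝ => y + t • e) 0 := hl.continuousAt
    have hc' : Filter.Tendsto (fun t : ℝ => y + t • e) (𝓝 0) (𝓝 y) := by
      simpa [ContinuousAt] using hc
    filter_upwards [hc'.eventually (φ.open_target.mem_nhds hy),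
      hc'.eventually ((φ.continuousAt_symm hy).eventually hU)] with t ht1 ht2
    refine hUc _ ht2 _ (mem_of_mem_nhds hU) ?_
    rw [φ.right_inv ht1, φ.right_inv hy]
    simp [h]
  have h5 := (h3.congr_of_eventuallyEq h4.symm).unique (hasDerivAt_const _ _)
  rw [dTransverse, (hasMFDerivAt_transverse hdψ hz).mfderiv]
  exact h5

theorem mfderiv_symm_sub_mem_tangent (F : Foliation p n M) (hφ : φ ∈ F.charts) {y : Euc p × Euc (n - p)}
    (hy : y ∈ φ.target) {e f : Euc p × Euc (n - p)} (h : e.2 = f.2) :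
    mfderiv 𝓘(ℝ, Euc p × Euc (n - p)) (𝓡 n) φ.symm y e -
      mfderiv 𝓘(ℝ, Euc p × Euc (n - p)) (𝓡 n) φ.symm y f ∈ F.tangent (φ.symm y) := by
  have h1 := (F.mem_tangent_symm_iff hφ hy (e - f)).2 (by simp [h])
  have h2 : mfderiv 𝓘(ℝ, Euc p × Euc (n - p)) (𝓡 n) φ.symm y (e - f) =
    mfderiv 𝓘(ℝ, Euc p × Euc (n - p)) (𝓡 n) φ.symm y e -
      mfderiv 𝓘(ℝ, Euc p × Euc (n - p)) (𝓡 n) φ.symm y f :=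
    map_sub (mfderiv 𝓘(ℝ, Euc p × Euc (n - p)) (𝓡 n) φ.symm y) e f
  rwa [h2] at h1

theorem exists_mfderiv_symm_eq (hd : φ.MDifferentiable (𝓡 n) 𝓘(ℝ, Euc p × Euc (n - p)))
    {y : Euc p × Euc (n - p)} (hy : y ∈ φ.target) (v : TangentSpace (𝓡 n) (φ.symm y)) :
    ∃ e : Euc p × Euc (n - p), mfderiv 𝓘(ℝ, Euc p × Euc (n - p)) (𝓡 n) φ.symm y e = v :=
  hd.symm.mfderiv_surjective hy v

end Derivatives

/-! ### The metric in foliated coordinates. -/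

section ChartInner

variable {p n : ℕ} {M : Type*} [TopologicalSpace M] [ChartedSpace (Euc n) M]
  [IsManifold (𝓡 n) ∞ M]
  (g : ContMDiffRiemannianMetric (𝓡 n) ∞ (Euc n) (fun x : M => TangentSpace (𝓡 n) x))
  (φ : OpenPartialHomeomorph M (Euc p × Euc (n - p)))

/-- The metric `g` in the coordinates of the chart `φ`, at the point with coordinates `y`. -/
def chartInner (y : Euc p × Euc (n - p)) :
    (Euc p × Euc (n - p)) →ₗ[ℝ] (Euc p × Euc (n - p)) →ₗ[ℝ] ℝ :=
  LinearMap.mk₂ ℝ (fun e f => g.inner (φ.symm y)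
      (mfderiv 𝓘(ℝ, Euc p × Euc (n - p)) (𝓡 n) φ.symm y e)
      (mfderiv 𝓘(ℝ, Euc p × Euc (n - p)) (𝓡 n) φ.symm y f))
    (fun e e' f => by
      erw [map_add, map_add]; rfl)
    (fun c e f => by
      erw [map_smul, map_smul]; rfl)
    (fun e f f' => by
      erw [map_add, map_add])
    (fun c e f => by
      erw [map_smul, map_smul])

variable {φ}

theorem chartInner_symm (y e f : Euc p × Euc (n - p)) :
    chartInner g φ y e f = chartInner g φ y f e := g.symm _ _ _

theorem chartInner_pos (hd : φ.MDifferentiable (𝓡 n) 𝓘(ℝ, Euc p × Euc (n - p)))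
    {y : Euc p × Euc (n - p)} (hy : y ∈ φ.target) (e : Euc p × Euc (n - p)) (he : e ≠ 0) :
    0 < chartInner g φ y e e := by
  refine g.pos _ _ fun h => he ?_
  exact (hd.symm.mfderiv_injective hy) (h.trans (map_zero _).symm)

/-- The metric in a smooth chart is jointly continuous in the point and the vector. -/
theorem continuousOn_chartInner
    (hφ : ContMDiffOn 𝓘(ℝ, Euc p × Euc (n - p)) (𝓡 n) ∞ φ.symm φ.target) :
    ContinuousOn (fun q : (Euc p × Euc (n - p)) × (Euc p × Euc (n - p)) =>
      chartInner g φ q.1 q.2 q.2) (φ.target ×ˢ Set.univ) := by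
  have h1 := hφ.continuousOn_tangentMapWithin (by simp) φ.open_target.uniqueMDiffOn
  have h2 : Continuous ((tangentBundleModelSpaceHomeomorph
      𝓘(ℝ, Euc p × Euc (n - p))).symm) := Homeomorph.continuous _
  have h3 := h1.comp (t := π _ (TangentSpace 𝓘(ℝ, Euc p × Euc (n - p))) ⁻¹' φ.target)
    (s := φ.target ×ˢ Set.univ) h2.continuousOn (fun q hq => hq.1)
  have h4 : ContinuousOn (fun q : (Euc p × Euc (n - p)) × (Euc p × Euc (n - p)) =>
      TotalSpace.mk' (Euc n) (E := fun x : M => TangentSpace (𝓡 n) x) (φ.symm q.1)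
        (mfderiv 𝓘(ℝ, Euc p × Euc (n - p)) (𝓡 n) φ.symm q.1 q.2)) (φ.target ×ˢ Set.univ) := by
    refine h3.congr fun q hq => ?_
    have h := mfderivWithin_of_isOpen (I := 𝓘(ℝ, Euc p × Euc (n - p))) (I' := 𝓡 n)
      (f := φ.symm) φ.open_target hq.1
    exact congrArg (fun L : (Euc p × Euc (n - p)) →L[ℝ] TangentSpace (𝓡 n) (φ.symm q.1) =>
      TotalSpace.mk' (Euc n) (E := fun x : M => TangentSpace (𝓡 n) x) (φ.symm q.1) (L q.2)) h.symm
  have h5 : ContinuousOn (fun q : (Euc p × Euc (n - p)) × (Euc p × Euc (n - p)) => φ.symm q.1)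
      (φ.target ×ˢ Set.univ) :=
    φ.continuousOn_symm.comp continuous_fst.continuousOn fun q hq => hq.1
  have h6 := (g.contMDiff.continuous.comp_continuousOn h5).clm_bundle_apply₂
    (F₁ := Euc n) (F₂ := Euc n) (F₃ := ℝ) (E₃ := Bundle.Trivial M ℝ) h4 h4
  intro q hq
  have h7 := h6 q hq
  simp only [FiberBundle.continuousWithinAt_totalSpace] at h7
  exact h7.2

/-- In a smooth chart, the metric at nearby points is comparable to the metric at `y₀`. -/
theorem eventually_chartInner_le
    (hd : φ.MDifferentiable (𝓡 n) 𝓘(ℝ, Euc p × Euc (n - p)))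
    (hφ : ContMDiffOn 𝓘(ℝ, Euc p × Euc (n - p)) (𝓡 n) ∞ φ.symm φ.target)
    {y₀ : Euc p × Euc (n - p)} (hy₀ : y₀ ∈ φ.target) :
    ∀ᶠ y in 𝓝 y₀, ∀ e, chartInner g φ y e e ≤ 2 * chartInner g φ y₀ e e ∧
      chartInner g φ y₀ e e ≤ 2 * chartInner g φ y e e := by
  have hcont := continuousOn_chartInner g hφ
  -- Compactness of the unit sphere makes the neighbourhood independent of `e`; homogeneity then
  -- removes the normalisation.
  have key : ∀ᶠ y in 𝓝 y₀, ∀ e ∈ Metric.sphere (0 : Euc p × Euc (n - p)) 1,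
      chartInner g φ y e e ≤ 2 * chartInner g φ y₀ e e ∧
      chartInner g φ y₀ e e ≤ 2 * chartInner g φ y e e := by
    refine (isCompact_sphere _ _).eventually_forall_of_forall_eventually fun e he => ?_
    have he0 : e ≠ 0 := by
      rintro rfl
      simp at he
    have hpos := chartInner_pos g hd hy₀ e he0
    have hc1 : ContinuousAt (fun q : (Euc p × Euc (n - p)) × (Euc p × Euc (n - p)) =>
        chartInner g φ q.1 q.2 q.2) (y₀, e) :=
      hcont.continuousAt ((φ.open_target.prod isOpen_univ).mem_nhds ⟨hy₀, trivial⟩)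
    have hc2 : ContinuousAt (fun q : (Euc p × Euc (n - p)) × (Euc p × Euc (n - p)) =>
        chartInner g φ y₀ q.2 q.2) (y₀, e) :=
      ContinuousAt.comp_of_eq (f := fun q : (Euc p × Euc (n - p)) × (Euc p × Euc (n - p)) =>
        (y₀, q.2)) hc1 (by fun_prop) rfl
    filter_upwards [hc1.eventually_lt (hc2.const_mul 2) (by simp only; linarith),
      hc2.eventually_lt (hc1.const_mul 2) (by simp only; linarith)] with q h1 h2
    exact ⟨h1.le, h2.le⟩
  filter_upwards [key] with y hy e
  by_cases he : e = 0
  · simp [he]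
  have hn : (0 : ℝ) < ‖e‖ := norm_pos_iff.2 he
  have h := hy (‖e‖⁻¹ • e) (by simp [norm_smul, hn.ne'])
  simp only [map_smul, LinearMap.smul_apply, smul_eq_mul] at h
  have hi : 0 < ‖e‖⁻¹ * ‖e‖⁻¹ := by positivity
  constructor
  · refine le_of_mul_le_mul_left ?_ hi
    linarith [h.1]
  · refine le_of_mul_le_mul_left ?_ hi
    linarith [h.2]

end ChartInner
end Foliation

namespace Foliation

/-! ### Transverse bounds on velocities and affine lifts of curves. -/

section TransverseBound

variable {p n : ℕ} {M : Type*} [TopologicalSpace M] [ChartedSpace (Euc n) M]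
  [IsManifold (𝓡 n) ∞ M]

/-- The component of `v` that is `g`-orthogonal to the leaves has squared `g`-norm at most `B`. -/
def TransverseBound (F : Foliation p n M)
    (g : ContMDiffRiemannianMetric (𝓡 n) ∞ (Euc n) (fun x : M => TangentSpace (𝓡 n) x))
    (z : M) (v : TangentSpace (𝓡 n) z) (B : ℝ) : Prop :=
  ∃ w : TangentSpace (𝓡 n) z, (∀ u ∈ F.tangent z, g.inner z w u = 0) ∧ v - w ∈ F.tangent z ∧
    g.inner z w w ≤ B

variable (F : Foliation p n M)
  (g : ContMDiffRiemannianMetric (𝓡 n) ∞ (Euc n) (fun x : M => TangentSpace (𝓡 n) x))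
  {φ : OpenPartialHomeomorph M (Euc p × Euc (n - p))}

/-- An orthogonal lift in coordinates gives a vector orthogonal to the leaves. -/
theorem inner_eq_zero_of_orthogonal_lift (hφ : φ ∈ F.charts) {y : Euc p × Euc (n - p)}
    (hy : y ∈ φ.target) {e : Euc p × Euc (n - p)}
    (he : ∀ a : Euc p, chartInner g φ y e (a, 0) = 0) :
    ∀ u ∈ F.tangent (φ.symm y), g.inner (φ.symm y)
      (mfderiv 𝓘(ℝ, Euc p × Euc (n - p)) (𝓡 n) φ.symm y e) u = 0 := by
  intro u hu
  obtain ⟨f, rfl⟩ := exists_mfderiv_symm_eq (F.mdifferentiable_of_mem_charts hφ) hy u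
  have hf := (F.mem_tangent_symm_iff hφ hy f).1 hu
  have h := he f.1
  rw [show (f.1, (0 : Euc (n - p))) = f from Prod.ext rfl hf.symm] at h
  exact h

/-- The component orthogonal to the leaves is no longer than the vector. -/
theorem transverseBound_self (z : M) (v : TangentSpace (𝓡 n) z) :
    F.TransverseBound g z v (g.inner z v v) := by
  obtain ⟨φ, hφ, hz⟩ := F.cover z
  obtain ⟨y, hy, rfl⟩ : ∃ y ∈ φ.target, φ.symm y = z := ⟨φ z, φ.map_source hz, φ.left_inv hz⟩
  have hd := F.mdifferentiable_of_mem_charts hφ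
  obtain ⟨e, rfl⟩ := exists_mfderiv_symm_eq hd hy v
  obtain ⟨A, hA⟩ := exists_orthogonal_lift (chartInner g φ y) (chartInner_pos g hd hy)
  refine ⟨mfderiv 𝓘(ℝ, Euc p × Euc (n - p)) (𝓡 n) φ.symm y (A e.2, e.2),
    F.inner_eq_zero_of_orthogonal_lift g hφ hy (hA e.2),
    F.mfderiv_symm_sub_mem_tangent hφ hy rfl, ?_⟩
  exact orthogonal_lift_le (chartInner g φ y) (chartInner_symm g y) (chartInner_pos g hd hy)
    (hA e.2) e.1

/-- The affine lifts `b ↦ (A b, b)` in the coordinates of `φ` near `y₀` keep transverse bounds and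
are almost orthogonal to the leaves. -/
def IsAdaptedLift (φ : OpenPartialHomeomorph M (Euc p × Euc (n - p)))
    (y₀ : Euc p × Euc (n - p)) (η : ℝ) (A : Euc (n - p) →L[ℝ] Euc p) : Prop :=
  ∀ z ∈ φ.source, φ z ∈ Metric.ball y₀ η → ∀ y ∈ Metric.ball y₀ η, (φ z).2 = y.2 →
    ∀ (v : TangentSpace (𝓡 n) z) (B : ℝ), F.TransverseBound g z v B →
      F.TransverseBound g (φ.symm y) (mfderiv 𝓘(ℝ, Euc p × Euc (n - p)) (𝓡 n) φ.symm y
        (A (dTransverse φ z v), dTransverse φ z v)) B ∧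
      chartInner g φ y (A (dTransverse φ z v), dTransverse φ z v)
        (A (dTransverse φ z v), dTransverse φ z v) ≤ 4 * B

/-- For a bundle-like metric, adapted lifts exist near every point. -/
theorem exists_isAdaptedLift (hg : F.IsRiemannian g) (z₀ : M) :
    ∃ φ ∈ F.charts, z₀ ∈ φ.source ∧ ∃ η > 0, Metric.ball (φ z₀) η ⊆ φ.target ∧
      ∃ A : Euc (n - p) →L[ℝ] Euc p, F.IsAdaptedLift g φ (φ z₀) η A := by
  obtain ⟨φ, hφ, hz₀, U, hU, h, hh⟩ := hg z₀
  have hd := F.mdifferentiable_of_mem_charts hφ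
  have hy₀ := φ.map_source hz₀
  have hcmp := eventually_chartInner_le g hd (F.contMDiffOn_symm φ hφ) hy₀
  have hU' : ∀ᶠ y in 𝓝 (φ z₀), φ.symm y ∈ U :=
    (φ.continuousAt_symm hy₀).eventually (by rwa [φ.left_inv hz₀])
  obtain ⟨η, hη, hball⟩ := Metric.eventually_nhds_iff_ball.1
    (hcmp.and (hU'.and (φ.open_target.mem_nhds hy₀)))
  -- The lift is orthogonal at the centre only and then kept constant; nearby this costs the factor
  -- 4 in the squared length.
  obtain ⟨A, hA⟩ := exists_orthogonal_lift (chartInner g φ (φ z₀)) (chartInner_pos g hd hy₀)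
  refine ⟨φ, hφ, hz₀, η, hη, fun y hy => (hball y hy).2.2, A.toContinuousLinearMap, ?_⟩
  intro z hz hzη y hyη hzy v B hvB
  obtain ⟨hcy, hyU, hy⟩ := hball y hyη
  have hzU : z ∈ U := by simpa [φ.left_inv hz] using (hball _ hzη).2.1
  obtain ⟨w, hw1, hw2, hw3⟩ := hvB
  set b := dTransverse φ z v with hb
  have hwb : dTransverse φ z w = b := by
    have h1 := hw2 φ hφ hz
    rw [dTransverse, map_sub] at h1
    exact (sub_eq_zero.1 h1).symm
  -- Here bundle-likeness enters: `h` sees only the transverse coordinate, which `z` and `y` share.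
  have hhb : h y.2 b b ≤ B := by
    have h1 := hh z hzU w w hw1 hw1
    rw [hwb, transverse, hzy] at h1
    rw [← h1]
    exact hw3
  obtain ⟨A', hA'⟩ := exists_orthogonal_lift (chartInner g φ y) (chartInner_pos g hd hy)
  have hw' := F.inner_eq_zero_of_orthogonal_lift g hφ hy (hA' b)
  have hval : chartInner g φ y (A' b, b) (A' b, b) ≤ B := by
    have h1 := hh (φ.symm y) hyU _ _ hw' hw'
    rw [dTransverse_mfderiv_symm hd hy, transverse, φ.right_inv hy] at h1
    exact h1.le.trans hhb
  refine ⟨⟨_, hw', F.mfderiv_symm_sub_mem_tangent hφ hy rfl, hval⟩, ?_⟩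
  -- Pass from `y` to the centre (factor 2), use that `A b` is the shortest lift there, and return
  -- to `y` (factor 2). The lift `A' b` orthogonal at `y` has squared length at most `B`.
  have h1 := (hcy (A b, b)).1
  have h2 := orthogonal_lift_le (chartInner g φ (φ z₀)) (chartInner_symm g _)
    (chartInner_pos g hd hy₀) (hA b) (A' b)
  have h3 := (hcy (A' b, b)).2
  simp only [LinearMap.coe_toContinuousLinearMap']
  linarith

/-- `γ` is a `C¹` curve on `[a, b]` whose velocity at time `t` has transverse component of squared
length at most `B t`. -/
structure IsTransverselyBounded (γ : ℝ → M) (a b : ℝ) (B : ℝ → ℝ) : Prop where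
  contMDiffOn : ContMDiffOn 𝓘(ℝ, ℝ) (𝓡 n) 1 γ (Set.Icc a b)
  bound : ∀ t ∈ Set.Icc a b, F.TransverseBound g (γ t)
    (mfderivWithin 𝓘(ℝ, ℝ) (𝓡 n) γ (Set.Icc a b) t (1 : ℝ)) (B t)

/-- Affine lifts of transversely bounded curves. -/
theorem IsTransverselyBounded.lift (hφ : φ ∈ F.charts) {y₀ : Euc p × Euc (n - p)} {η : ℝ}
    (hη : Metric.ball y₀ η ⊆ φ.target) {A : Euc (n - p) →L[ℝ] Euc p}
    (hA : F.IsAdaptedLift g φ y₀ η A) {γ : ℝ → M} {a b : ℝ} (hab : a < b) {B : ℝ → ℝ}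
    (hγ : F.IsTransverselyBounded g γ a b B)
    (hγs : ∀ t ∈ Set.Icc a b, γ t ∈ φ.source ∧ φ (γ t) ∈ Metric.ball y₀ η)
    {y₁ : Euc p × Euc (n - p)} (hy₁ : y₁.2 = (φ (γ a)).2) {Y : ℝ → Euc p × Euc (n - p)}
    (hYdef : ∀ t, Y t =
      y₁ + (A ((φ (γ t)).2 - (φ (γ a)).2), (φ (γ t)).2 - (φ (γ a)).2))
    (hYη : ∀ t ∈ Set.Icc a b, Y t ∈ Metric.ball y₀ η) :
    F.IsTransverselyBounded g (fun t => φ.symm (Y t)) a b B ∧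
    ∀ t ∈ Set.Icc a b, g.inner (φ.symm (Y t))
      (mfderivWithin 𝓘(ℝ, ℝ) (𝓡 n) (fun t => φ.symm (Y t)) (Set.Icc a b) t (1 : ℝ))
      (mfderivWithin 𝓘(ℝ, ℝ) (𝓡 n) (fun t => φ.symm (Y t)) (Set.Icc a b) t (1 : ℝ)) ≤ 4 * B t := by
  have hd := F.mdifferentiable_of_mem_charts hφ
  have hY2 : ∀ t, (Y t).2 = (φ (γ t)).2 := fun t => by simp [hYdef, hy₁]
  have hYeq : Y = fun t => y₁ + (A.prod (ContinuousLinearMap.id ℝ _))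
      (transverse φ (γ t) - transverse φ (γ a)) := funext hYdef
  have hφγ : ContMDiffOn 𝓘(ℝ, ℝ) 𝓘(ℝ, Euc p × Euc (n - p)) 1 (φ ∘ γ) (Set.Icc a b) :=
    ((F.contMDiffOn φ hφ).of_le (by simp)).comp hγ.contMDiffOn fun t ht => (hγs t ht).1
  have hYsm : ContMDiffOn 𝓘(ℝ, ℝ) 𝓘(ℝ, Euc p × Euc (n - p)) 1 Y (Set.Icc a b) := by
    rw [contMDiffOn_iff_contDiffOn] at hφγ ⊢
    rw [hYeq]
    refine contDiffOn_const.add ((A.prod (ContinuousLinearMap.id ℝ _)).contDiff.comp_contDiffOn ?_)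
    exact (contDiff_snd.comp_contDiffOn hφγ).sub contDiffOn_const
  have hder : ∀ t ∈ Set.Icc a b,
      mfderivWithin 𝓘(ℝ, ℝ) (𝓡 n) (fun t => φ.symm (Y t)) (Set.Icc a b) t (1 : ℝ) =
      mfderiv 𝓘(ℝ, Euc p × Euc (n - p)) (𝓡 n) φ.symm (Y t)
        (A (dTransverse φ (γ t) (mfderivWithin 𝓘(ℝ, ℝ) (𝓡 n) γ (Set.Icc a b) t (1 : ℝ))),
          dTransverse φ (γ t) (mfderivWithin 𝓘(ℝ, ℝ) (𝓡 n) γ (Set.Icc a b) t (1 : ℝ))) := by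
    intro t ht
    have hγt := ((hγ.contMDiffOn t ht).mdifferentiableWithinAt (by simp)).hasMFDerivWithinAt
    have hct := (hasMFDerivAt_transverse hd (hγs t ht).1).comp_hasMFDerivWithinAt t hγt
    have hct' : HasFDerivWithinAt (transverse φ ∘ γ) _ (Set.Icc a b) t :=
      hasMFDerivWithinAt_iff_hasFDerivWithinAt.1 hct
    have hYt := ((A.prod (ContinuousLinearMap.id ℝ _)).hasFDerivAt.comp_hasFDerivWithinAt t
      (hct'.sub_const (transverse φ (γ a)))).const_add y₁
    have hYt' : HasFDerivWithinAt Y _ (Set.Icc a b) t := 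
      hYt.congr (fun s _ => by rw [hYeq]; rfl) (by rw [hYeq]; rfl)
    have hfin := (hd.mdifferentiableAt_symm (hη (hYη t ht))).hasMFDerivAt.comp_hasMFDerivWithinAt t
      (hasMFDerivWithinAt_iff_hasFDerivWithinAt.2 hYt')
    have hu : UniqueMDiffWithinAt 𝓘(ℝ, ℝ) (Set.Icc a b) t :=
      (uniqueDiffOn_Icc hab t ht).uniqueMDiffWithinAt
    have := hfin.mfderivWithin hu
    rw [dTransverse_eq hd (hγs t ht).1]
    exact DFunLike.congr_fun this (1 : ℝ)
  refine ⟨⟨((F.contMDiffOn_symm φ hφ).of_le (by simp)).comp hYsm fun t ht => hη (hYη t ht),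
    fun t ht => ?_⟩, fun t ht => ?_⟩
  · rw [hder t ht]
    exact (hA _ (hγs t ht).1 (hγs t ht).2 _ (hYη t ht) (hY2 t).symm _ _ (hγ.bound t ht)).1
  · rw [hder t ht]
    exact (hA _ (hγs t ht).1 (hγs t ht).2 _ (hYη t ht) (hY2 t).symm _ _ (hγ.bound t ht)).2

end TransverseBound

end Foliation

namespace Foliation

/-! ### Moving short curves along a leaf. -/

section Equidistance

open Manifold

variable {p n : ℕ} {M : Type*} [MetricSpace M] [ChartedSpace (Euc n) M]
  [RiemannianBundle (fun x : M => TangentSpace (𝓡 n) x)]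

/-- Comparison of lengths from a pointwise comparison of velocities. -/
theorem pathELength_le_of_inner_le {γ γ₁ : ℝ → M} {a b K : ℝ} (hK : 0 ≤ K)
    (h : ∀ t ∈ Set.Icc a b,
      inner ℝ (mfderivWithin 𝓘(ℝ, ℝ) (𝓡 n) γ₁ (Set.Icc a b) t (1 : ℝ))
          (mfderivWithin 𝓘(ℝ, ℝ) (𝓡 n) γ₁ (Set.Icc a b) t (1 : ℝ)) ≤
        K ^ 2 * inner ℝ (mfderivWithin 𝓘(ℝ, ℝ) (𝓡 n) γ (Set.Icc a b) t (1 : ℝ))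
          (mfderivWithin 𝓘(ℝ, ℝ) (𝓡 n) γ (Set.Icc a b) t (1 : ℝ))) :
    pathELength (𝓡 n) γ₁ a b ≤ ENNReal.ofReal K * pathELength (𝓡 n) γ a b := by
  rw [pathELength_eq_lintegral_mfderivWithin_Icc, pathELength_eq_lintegral_mfderivWithin_Icc,
    ← MeasureTheory.lintegral_const_mul' _ _ ENNReal.ofReal_ne_top]
  refine MeasureTheory.setLIntegral_mono' measurableSet_Icc fun t ht => ?_
  have h1 := h t ht
  rw [real_inner_self_eq_norm_sq, real_inner_self_eq_norm_sq, ← mul_pow] at h1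
  have h2 := (sq_le_sq₀ (norm_nonneg _) (by positivity)).1 h1
  rw [← ofReal_norm, ← ofReal_norm, ← ENNReal.ofReal_mul hK]
  exact ENNReal.ofReal_le_ofReal h2

variable [IsRiemannianManifold (𝓡 n) M]

theorem edist_le_pathELength {γ : ℝ → M} {a b t : ℝ}
    (hγ : ContMDiffOn 𝓘(ℝ, ℝ) (𝓡 n) 1 γ (Set.Icc a b)) (ht : t ∈ Set.Icc a b) :
    edist (γ a) (γ t) ≤ pathELength (𝓡 n) γ a b := by
  rw [IsRiemannianManifold.out (I := 𝓡 n) (γ a) (γ t)]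
  exact (riemannianEDist_le_pathELength (hγ.mono (Set.Icc_subset_Icc_right ht.2)) rfl rfl
    ht.1).trans (pathELength_mono le_rfl ht.2)

variable [IsManifold (𝓡 n) ∞ M]
  (F : Foliation p n M)
  (g : ContMDiffRiemannianMetric (𝓡 n) ∞ (Euc n) (fun x : M => TangentSpace (𝓡 n) x))

/-- Near every point, short transversely bounded curves can be moved along the plaques. -/
theorem exists_plaque_lift (hg : F.IsRiemannian g) (z₀ : M) :
    ∃ ρ > 0, ∃ φ ∈ F.charts, Metric.ball z₀ ρ ⊆ φ.source ∧
      ∀ z ∈ Metric.ball z₀ ρ, ∀ z₁ ∈ Metric.ball z₀ ρ, (φ z).2 = (φ z₁).2 →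
        ∀ (γ : ℝ → M) (a b : ℝ) (B : ℝ → ℝ), a < b → γ a = z →
          F.IsTransverselyBounded g γ a b B →
          pathELength (𝓡 n) γ a b < ENNReal.ofReal ρ →
          ∃ γ₁ : ℝ → M, γ₁ a = z₁ ∧ F.IsTransverselyBounded g γ₁ a b B ∧ γ₁ b ∈ F.leaf (γ b) ∧
            ∀ t ∈ Set.Icc a b, g.inner (γ₁ t)
              (mfderivWithin 𝓘(ℝ, ℝ) (𝓡 n) γ₁ (Set.Icc a b) t (1 : ℝ))
              (mfderivWithin 𝓘(ℝ, ℝ) (𝓡 n) γ₁ (Set.Icc a b) t (1 : ℝ)) ≤ 4 * B t := by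
  obtain ⟨φ, hφ, hz₀, η, hη, hηt, A, hA⟩ := F.exists_isAdaptedLift g hg z₀
  -- If all the points used are `δ`-close to the centre in coordinates, the lifted curve stays
  -- within `δ + (‖A‖ + 1) * 2 δ = (2 ‖A‖ + 3) δ` of it.
  have hη' : 0 < η / (2 * ‖A‖ + 3) := by positivity
  have hηη' : η / (2 * ‖A‖ + 3) ≤ η := div_le_self hη.le (by linarith [norm_nonneg A])
  obtain ⟨ρ, hρ, hball⟩ := Metric.eventually_nhds_iff_ball.1
    ((φ.open_source.eventually_mem hz₀).and
      ((φ.continuousAt hz₀).eventually (Metric.ball_mem_nhds _ hη')))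
  have hball' : ∀ z ∈ Metric.ball z₀ ρ, z ∈ φ.source ∧ dist (φ z) (φ z₀) < η / (2 * ‖A‖ + 3) :=
    fun z hz => hball z hz
  -- Half of the radius is for the starting point and half for the length of the curve.
  have hsub : Metric.ball z₀ (ρ / 2) ⊆ Metric.ball z₀ ρ := Metric.ball_subset_ball (by linarith)
  refine ⟨ρ / 2, by positivity, φ, hφ, fun z hz => (hball' z (hsub hz)).1, ?_⟩
  intro z hz z₁ hz₁ hzz γ a b B hab hγa hγ hlen
  have hγball : ∀ t ∈ Set.Icc a b, γ t ∈ Metric.ball z₀ ρ := by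
    intro t ht
    have h1 := (edist_le_pathELength hγ.contMDiffOn ht).trans_lt hlen
    rw [edist_lt_ofReal, dist_comm, hγa] at h1
    have h2 := dist_triangle (γ t) z z₀
    rw [Metric.mem_ball] at hz ⊢
    linarith
  have hγs : ∀ t ∈ Set.Icc a b, γ t ∈ φ.source ∧ φ (γ t) ∈ Metric.ball (φ z₀) η :=
    fun t ht => ⟨(hball' _ (hγball t ht)).1, (hball' _ (hγball t ht)).2.trans_le hηη'⟩
  have ha : a ∈ Set.Icc a b := ⟨le_rfl, hab.le⟩
  have hb : b ∈ Set.Icc a b := ⟨hab.le, le_rfl⟩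
  set Y : ℝ → Euc p × Euc (n - p) := fun t =>
    φ z₁ + (A ((φ (γ t)).2 - (φ (γ a)).2), (φ (γ t)).2 - (φ (γ a)).2) with hY
  have hYη : ∀ t ∈ Set.Icc a b, Y t ∈ Metric.ball (φ z₀) η := by
    intro t ht
    set c := (φ (γ t)).2 - (φ (γ a)).2 with hc
    have h1 := (hball' _ (hγball t ht)).2
    have h2 := (hball' _ (hγball a ha)).2
    have h3 := (hball' _ (hsub hz₁)).2
    have h4 : ‖c‖ < 2 * (η / (2 * ‖A‖ + 3)) := by
      calc ‖c‖ ≤ ‖φ (γ t) - φ (γ a)‖ := norm_snd_le (φ (γ t) - φ (γ a))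
        _ = dist (φ (γ t)) (φ (γ a)) := (dist_eq_norm _ _).symm
        _ ≤ dist (φ (γ t)) (φ z₀) + dist (φ (γ a)) (φ z₀) := dist_triangle_right _ _ _
        _ < _ := by linarith
    have h5 : ‖(A c, c)‖ ≤ (‖A‖ + 1) * ‖c‖ := by
      refine norm_prod_le_iff.2 ⟨?_, ?_⟩
      · exact (A.le_opNorm c).trans (by nlinarith [norm_nonneg c])
      · show ‖c‖ ≤ _
        nlinarith [norm_nonneg c, norm_nonneg A]
    have h6 : dist (Y t) (φ z₀) ≤ dist (φ z₁) (φ z₀) + ‖(A c, c)‖ := by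
      rw [dist_eq_norm, dist_eq_norm]
      calc ‖Y t - φ z₀‖ = ‖(φ z₁ - φ z₀) + (A c, c)‖ := by
            congr 1; simp only [hY, ← hc]; abel
        _ ≤ _ := norm_add_le _ _
    have h7 : (‖A‖ + 1) * ‖c‖ ≤ (‖A‖ + 1) * (2 * (η / (2 * ‖A‖ + 3))) :=
      mul_le_mul_of_nonneg_left h4.le (by positivity)
    have h8 : η / (2 * ‖A‖ + 3) + (‖A‖ + 1) * (2 * (η / (2 * ‖A‖ + 3))) = η := by
      field_simp
      ring
    rw [Metric.mem_ball]
    linarith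
  have hYa : Y a = φ z₁ := by simp [hY]
  have hlift := IsTransverselyBounded.lift F g hφ hηt hA hab hγ hγs
    (y₁ := φ z₁) (by rw [hγa, hzz]) (fun t => rfl) hYη
  have hz₁s := (hball' _ (hsub hz₁)).1
  refine ⟨fun t => φ.symm (Y t), ?_, hlift.1, ?_, hlift.2⟩
  · simp only [hYa]
    exact φ.left_inv hz₁s
  · refine F.mem_leaf_of_mem_ball hφ hηt (hγs b hb).1 (φ.map_target (hηt (hYη b hb)))
      (hγs b hb).2 ?_ ?_
    · simp only [φ.right_inv (hηt (hYη b hb))]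
      exact hYη b hb
    · simp only [φ.right_inv (hηt (hYη b hb))]
      simp [hY, ← hzz, hγa]

/-- Short transversely bounded curves can be moved along the plaques, uniformly on a compact
manifold. -/
theorem exists_uniform_plaque_lift [CompactSpace M] (hg : F.IsRiemannian g) :
    ∃ r > 0, ∀ x : M, ∃ φ ∈ F.charts, ∃ V : Set M, IsOpen V ∧ x ∈ V ∧ V ⊆ φ.source ∧
      ∀ z ∈ V, ∀ z₁ ∈ V, (φ z).2 = (φ z₁).2 →
        ∀ (γ : ℝ → M) (a b : ℝ) (B : ℝ → ℝ), a < b → γ a = z →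
          F.IsTransverselyBounded g γ a b B →
          pathELength (𝓡 n) γ a b < ENNReal.ofReal r →
          ∃ γ₁ : ℝ → M, γ₁ a = z₁ ∧ F.IsTransverselyBounded g γ₁ a b B ∧ γ₁ b ∈ F.leaf (γ b) ∧
            ∀ t ∈ Set.Icc a b, g.inner (γ₁ t)
              (mfderivWithin 𝓘(ℝ, ℝ) (𝓡 n) γ₁ (Set.Icc a b) t (1 : ℝ))
              (mfderivWithin 𝓘(ℝ, ℝ) (𝓡 n) γ₁ (Set.Icc a b) t (1 : ℝ)) ≤ 4 * B t := by
  choose ρ hρ φ hφ hs h using F.exists_plaque_lift g hg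
  obtain ⟨T, hT⟩ := isCompact_univ.elim_nhds_subcover (fun z => Metric.ball z (ρ z))
    (fun z _ => Metric.ball_mem_nhds z (hρ z))
  obtain ⟨r, hr, hrT⟩ : ∃ r > 0, ∀ z ∈ T, r ≤ ρ z := by
    classical
    clear hT
    induction T using Finset.induction_on with
    | empty => exact ⟨1, one_pos, by simp⟩
    | insert z T _ ih =>
      obtain ⟨r, hr, hrT⟩ := ih
      refine ⟨min r (ρ z), lt_min hr (hρ z), fun w hw => ?_⟩
      rcases Finset.mem_insert.1 hw with rfl | hw
      · exact min_le_right _ _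
      · exact (min_le_left _ _).trans (hrT w hw)
  refine ⟨r, hr, fun x => ?_⟩
  obtain ⟨z, hz, hxz⟩ := Set.mem_iUnion₂.1 (hT.2 (Set.mem_univ x))
  exact ⟨φ z, hφ z, _, Metric.isOpen_ball, hxz, hs z, fun z' hz' z₁ hz₁ heq γ a b B hab hγa hγ hl =>
    h z z' hz' z₁ hz₁ heq γ a b B hab hγa hγ
      (hl.trans_le (ENNReal.ofReal_le_ofReal (hrT z hz)))⟩

/-- If `F` is Riemannian for a metric comparable to that of `M`, then a short curve that starts on
a leaf can be moved along this leaf. -/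
theorem exists_edist_le_of_short_curve [CompactSpace M] (hg : F.IsRiemannian g) {C : ℝ}
    (hC : 1 ≤ C) (hgC : ∀ (x : M) (v : TangentSpace (𝓡 n) x),
      1 / C * inner ℝ v v ≤ g.inner x v v ∧ g.inner x v v ≤ C * inner ℝ v v) :
    ∃ r > 0, ∀ (γ : ℝ → M) (a b : ℝ), a < b → ContMDiffOn 𝓘(ℝ, ℝ) (𝓡 n) 1 γ (Set.Icc a b) →
      pathELength (𝓡 n) γ a b < ENNReal.ofReal r → ∀ x ∈ F.leaf (γ a), ∃ y ∈ F.leaf (γ b),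
        edist x y ≤ ENNReal.ofReal (2 * C) * pathELength (𝓡 n) γ a b := by
  obtain ⟨r, hr, h⟩ := F.exists_uniform_plaque_lift g hg
  have hC0 : 0 < C := by linarith
  -- Every moved copy may be `2 C` times as long as `γ` and must still be shorter than `r` to be
  -- moved again.
  refine ⟨r / (2 * C), by positivity, fun γ a b hab hγ hlen x hx => ?_⟩
  have hlen' : ENNReal.ofReal (2 * C) * pathELength (𝓡 n) γ a b < ENNReal.ofReal r := by
    have h1 := ENNReal.mul_lt_mul_right (a := ENNReal.ofReal (2 * C)) (by simp; linarith)
      ENNReal.ofReal_ne_top hlen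
    rwa [← ENNReal.ofReal_mul (by positivity), mul_div_cancel₀ _ (by positivity)] at h1
  -- The bound comes from the original curve and is the same for all moved copies, which keeps the
  -- length factor in `S` from growing.
  let B : ℝ → ℝ := fun t => C * inner ℝ (mfderivWithin 𝓘(ℝ, ℝ) (𝓡 n) γ (Set.Icc a b) t (1 : ℝ))
    (mfderivWithin 𝓘(ℝ, ℝ) (𝓡 n) γ (Set.Icc a b) t (1 : ℝ))
  let S : Set M := {x | ∃ γ₁ : ℝ → M, γ₁ a = x ∧ F.IsTransverselyBounded g γ₁ a b B ∧
    γ₁ b ∈ F.leaf (γ b) ∧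
    pathELength (𝓡 n) γ₁ a b ≤ ENNReal.ofReal (2 * C) * pathELength (𝓡 n) γ a b}
  have hS0 : γ a ∈ S := by
    refine ⟨γ, rfl, ⟨hγ, fun t ht => ?_⟩, F.mem_leaf_self _, ?_⟩
    · obtain ⟨w, h1, h2, h3⟩ := F.transverseBound_self g (γ t)
        (mfderivWithin 𝓘(ℝ, ℝ) (𝓡 n) γ (Set.Icc a b) t (1 : ℝ))
      exact ⟨w, h1, h2, h3.trans (hgC _ _).2⟩
    · exact le_mul_of_one_le_left' (by rw [ENNReal.one_le_ofReal]; linarith)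
  have hS : F.leaf (γ a) ⊆ S := by
    refine F.leaf_subset_of_plaque_invariant S (fun x => ?_) hS0
    obtain ⟨φ, hφ, V, hV, hxV, hVs, hl⟩ := h x
    refine ⟨φ, hφ, V, hV, hxV, hVs, fun z hz w hw hzw => ?_⟩
    rintro ⟨γ₁, hγ₁a, hγ₁, hγ₁b, hγ₁l⟩
    obtain ⟨γ₂, h1, h2, h3, h4⟩ := hl z hz w hw hzw γ₁ a b B hab hγ₁a hγ₁ (hγ₁l.trans_lt hlen')
    refine ⟨γ₂, h1, h2, F.leaf_eq_of_mem hγ₁b ▸ h3, ?_⟩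
    -- Squared speeds grow by `4 * C * C`: 4 from the lift, one `C` in `B`, one `C` from returning
    -- to the original metric.
    refine pathELength_le_of_inner_le (by positivity) fun t ht => ?_
    have h5 := (hgC (γ₂ t) (mfderivWithin 𝓘(ℝ, ℝ) (𝓡 n) γ₂ (Set.Icc a b) t (1 : ℝ))).1
    have h6 := h5.trans (h4 t ht)
    rw [one_div, inv_mul_le_iff₀ hC0] at h6
    refine h6.trans (le_of_eq ?_)
    simp only [B]
    ring
  obtain ⟨γ₁, rfl, h1, h2, h3⟩ := hS hx
  exact ⟨γ₁ b, h2, (edist_le_pathELength h1.contMDiffOn ⟨hab.le, le_rfl⟩).trans h3⟩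

end Equidistance
end Foliation

namespace Foliation

/-! ### From short curves to the distance `ρ` of leaves. -/

section LeafDistance

open Manifold

variable {p n : ℕ} {M : Type*} [MetricSpace M] [ChartedSpace (Euc n) M]
  [RiemannianBundle (fun x : M => TangentSpace (𝓡 n) x)]

/-- A curve of finite length can be cut into pieces of small length. -/
theorem exists_subdivision {γ : ℝ → M} (hγ : pathELength (𝓡 n) γ 0 1 ≠ ⊤) {r : ℝ≥0∞}
    (hr : r ≠ 0) : ∃ N : ℕ, 0 < N ∧ ∀ i < N,
      pathELength (𝓡 n) γ ((i : ℝ) / N) (((i + 1 : ℕ) : ℝ) / N) < r := by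
  rw [pathELength_eq_lintegral_mfderiv_Icc] at hγ
  -- Absolute continuity of the length integral: short time intervals carry little length.
  obtain ⟨δ, hδ, h⟩ := MeasureTheory.exists_pos_setLIntegral_lt_of_measure_lt hγ hr
  obtain ⟨N, hN0, hN⟩ : ∃ N : ℕ, 0 < N ∧ ENNReal.ofReal (1 / N) < δ := by
    obtain ⟨δ', hδ'0, hδ'⟩ := ENNReal.lt_iff_exists_nnreal_btwn.1 hδ
    have hpos : (0 : ℝ) < δ' := by exact_mod_cast hδ'0
    obtain ⟨k, hk⟩ := exists_nat_one_div_lt hpos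
    refine ⟨k + 1, k.succ_pos, lt_trans ?_ hδ'⟩
    rw [← ENNReal.ofReal_coe_nnreal]
    push_cast
    exact (ENNReal.ofReal_lt_ofReal_iff hpos).2 hk
  have hN' : (0 : ℝ) < N := by exact_mod_cast hN0
  refine ⟨N, hN0, fun i hi => ?_⟩
  have hsub : Set.Icc ((i : ℝ) / N) (((i + 1 : ℕ) : ℝ) / N) ⊆ Set.Icc 0 1 := by
    refine Set.Icc_subset_Icc (by positivity) ?_
    rw [div_le_one hN']
    exact_mod_cast hi
  have hmeas : MeasureTheory.volume.restrict (Set.Icc (0 : ℝ) 1)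
      (Set.Icc ((i : ℝ) / N) (((i + 1 : ℕ) : ℝ) / N)) < δ := by
    rw [MeasureTheory.Measure.restrict_apply measurableSet_Icc, Set.inter_eq_left.2 hsub,
      Real.volume_Icc]
    convert hN using 2
    push_cast
    field_simp
    ring
  have := h _ hmeas
  rwa [MeasureTheory.Measure.restrict_restrict measurableSet_Icc, Set.inter_eq_left.2 hsub,
    ← pathELength_eq_lintegral_mfderiv_Icc] at this

variable [IsRiemannianManifold (𝓡 n) M] [IsManifold (𝓡 n) ∞ M] [CompactSpace M]

/-- `F` is Riemannian for a metric that is comparable, up to the factor `C`, to that of `M`. -/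
def IsComparablyRiemannian (F : Foliation p n M) (C : ℝ) : Prop :=
  ∃ g : ContMDiffRiemannianMetric (𝓡 n) ∞ (Euc n) (fun x : M => TangentSpace (𝓡 n) x),
    (∀ (x : M) (v : TangentSpace (𝓡 n) x),
      1 / C * inner ℝ v v ≤ g.inner x v v ∧ g.inner x v v ≤ C * inner ℝ v v) ∧
    F.IsRiemannian g

variable {F : Foliation p n M} {C : ℝ}

/-- Every curve that starts on a leaf can be moved along this leaf, up to a factor in the
distance. -/
theorem IsComparablyRiemannian.exists_edist_le_of_curve (hF : F.IsComparablyRiemannian C)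
    (hC : 1 ≤ C) {γ : ℝ → M} (hγ : ContMDiffOn 𝓘(ℝ, ℝ) (𝓡 n) 1 γ (Set.Icc 0 1))
    (hl : pathELength (𝓡 n) γ 0 1 ≠ ⊤) {x : M} (hx : x ∈ F.leaf (γ 0)) :
    ∃ y ∈ F.leaf (γ 1), edist x y ≤ ENNReal.ofReal (2 * C) * pathELength (𝓡 n) γ 0 1 := by
  obtain ⟨g, hgC, hg⟩ := hF
  obtain ⟨r, hr, h⟩ := F.exists_edist_le_of_short_curve g hg hC hgC
  obtain ⟨N, hN0, hN⟩ := exists_subdivision hl (r := ENNReal.ofReal r) (by simpa using hr)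
  have hN' : (0 : ℝ) < N := by exact_mod_cast hN0
  have key : ∀ i : ℕ, i ≤ N → ∃ y ∈ F.leaf (γ ((i : ℝ) / N)),
      edist x y ≤ ENNReal.ofReal (2 * C) * pathELength (𝓡 n) γ 0 ((i : ℝ) / N) := by
    intro i
    induction i with
    | zero => exact fun _ => ⟨x, by simpa using hx, by simp⟩
    | succ i ih =>
      intro hi
      obtain ⟨y, hy, hxy⟩ := ih (by omega)
      have hlt : (i : ℝ) / N < ((i + 1 : ℕ) : ℝ) / N := by
        push_cast
        gcongr
        linarith
      have hle : ((i + 1 : ℕ) : ℝ) / N ≤ 1 := by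
        rw [div_le_one hN']
        exact_mod_cast hi
      have h0 : (0 : ℝ) ≤ (i : ℝ) / N := by positivity
      obtain ⟨y', hy', hyy'⟩ := h γ _ _ hlt (hγ.mono (Set.Icc_subset_Icc h0 hle))
        (hN i hi) y hy
      refine ⟨y', hy', (edist_triangle x y y').trans ?_⟩
      rw [← pathELength_add h0 hlt.le, mul_add]
      exact add_le_add hxy hyy'
  have := key N le_rfl
  rwa [div_self hN'.ne'] at this

/-- A curve almost realising the distance of the two leaves starts at some point of `L`; moving it
along `L` makes it start at the given `x`. -/
theorem IsComparablyRiemannian.exists_edist_le_of_setDist_lt (hF : F.IsComparablyRiemannian C)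
    (hC : 1 ≤ C) {L L' : F.LeafSpace} {s : ℝ≥0∞} (h : F.setDist L L' < s) {x : M}
    (hx : (⟦x⟧ : F.LeafSpace) = L) :
    ∃ y : M, (⟦y⟧ : F.LeafSpace) = L' ∧ edist x y ≤ ENNReal.ofReal (2 * C) * s := by
  simp only [setDist, iInf_lt_iff] at h
  obtain ⟨x₀, y₀, hx₀, hy₀, h⟩ := h
  rw [IsRiemannianManifold.out (I := 𝓡 n) x₀ y₀] at h
  obtain ⟨γ, h0, h1, hγ, hl⟩ := exists_lt_of_riemannianEDist_lt h
  have hxl : x ∈ F.leaf (γ 0) := by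
    rw [h0, ← mk_eq_mk_iff_mem, hx₀, hx]
  obtain ⟨y, hy, hxy⟩ := hF.exists_edist_le_of_curve hC hγ hl.ne_top hxl
  refine ⟨y, ?_, hxy.trans (by gcongr)⟩
  rw [← hy₀, eq_comm, mk_eq_mk_iff_mem, ← h1]
  exact hy

/-- Points of a leaf are close to every leaf that is `ρ`-close. -/
theorem IsComparablyRiemannian.exists_edist_le_of_rho_lt (hF : F.IsComparablyRiemannian C)
    (hC : 1 ≤ C) {L L' : F.LeafSpace} {s : ℝ≥0∞} (h : F.rho L L' < s) {x : M}
    (hx : (⟦x⟧ : F.LeafSpace) = L) :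
    ∃ y : M, (⟦y⟧ : F.LeafSpace) = L' ∧ edist x y ≤ ENNReal.ofReal (2 * C) * s := by
  simp only [rho, iInf_lt_iff] at h
  obtain ⟨m, S, hS0, hSm, h⟩ := h
  -- The distances between consecutive leaves are infima, so each of the `m` steps is allowed an
  -- excess `ε`.
  obtain ⟨ε, hε, hεs⟩ : ∃ ε : NNReal, 0 < ε ∧
      ∑ i ∈ Finset.range m, F.setDist (S i) (S (i + 1)) + (m : ℝ≥0∞) * ε < s := by
    obtain ⟨ε, hε, h1⟩ := ENNReal.exists_nnreal_pos_mul_lt (a := (m : ℝ≥0∞)) (by simp)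
      (tsub_pos_of_lt h).ne'
    exact ⟨ε, hε, by rw [mul_comm]; exact lt_tsub_iff_left.1 h1⟩
  have key : ∀ i ≤ m, ∃ y : M, (⟦y⟧ : F.LeafSpace) = S i ∧ edist x y ≤ ENNReal.ofReal (2 * C) *
      (∑ j ∈ Finset.range i, F.setDist (S j) (S (j + 1)) + (i : ℝ≥0∞) * ε) := by
    intro i
    induction i with
    | zero => exact fun _ => ⟨x, hx.trans hS0.symm, by simp⟩
    | succ i ih =>
      intro hi
      obtain ⟨y, hy, hxy⟩ := ih (by omega)
      have hfin : F.setDist (S i) (S (i + 1)) ≠ ⊤ := by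
        refine ne_top_of_le_ne_top h.ne_top ?_
        exact Finset.single_le_sum (f := fun i => F.setDist (S i) (S (i + 1)))
          (fun _ _ => zero_le) (Finset.mem_range.2 hi)
      obtain ⟨y', hy', hyy'⟩ := hF.exists_edist_le_of_setDist_lt hC
        (ENNReal.lt_add_right hfin (by exact_mod_cast hε.ne' : (ε : ℝ≥0∞) ≠ 0)) hy
      refine ⟨y', hy', (edist_triangle x y y').trans ((add_le_add hxy hyy').trans (le_of_eq ?_))⟩
      rw [Finset.sum_range_succ]
      push_cast
      ring
  obtain ⟨y, hy, hxy⟩ := key m le_rfl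
  exact ⟨y, hy.trans hSm, hxy.trans (by gcongr)⟩

end LeafDistance
end Foliation

/-! ### Capacity -/

section Capacity

variable {X : Type*} {e : X → X → ℝ≥0∞} {r : ℝ}

theorem card_le_capacity {s : Finset X}
    (hs : (s : Set X).PairwiseDisjoint fun x => eBall e x r) : (s.card : ℕ∞) ≤ capacity e r :=
  le_iSup₂_of_le s hs le_rfl

/-- A supremum of natural numbers that is at least a finite `m` has a member that is at least `m`.
-/
theorem exists_card_ge_of_le_capacity {m : ℕ} (h : (m : ℕ∞) ≤ capacity e r) :
    ∃ s : Finset X, (s : Set X).PairwiseDisjoint (fun x => eBall e x r) ∧ m ≤ s.card := by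
  by_contra! hcon
  have hm : 0 < m := by simpa using hcon ∅ (by simp)
  have h1 : capacity e r ≤ ((m - 1 : ℕ) : ℕ∞) :=
    iSup₂_le fun s hs => by exact_mod_cast Nat.le_sub_one_of_lt (hcon s hs)
  have h2 : (m : ℕ∞) ≤ ((m - 1 : ℕ) : ℕ∞) := h.trans h1
  have h3 : m ≤ m - 1 := by exact_mod_cast h2
  omega

/-- A largest family of disjoint balls meets every other ball. -/
theorem exists_maximal_family {N : ℕ} (h : capacity e r = N) :
    ∃ s : Finset X, s.card = N ∧
      ∀ x, x ∈ s ∨ ∃ a ∈ s, ∃ z, e x z < ENNReal.ofReal r ∧ e a z < ENNReal.ofReal r := by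
  classical
  obtain ⟨s, hs, hcard⟩ := exists_card_ge_of_le_capacity h.ge
  have hcard' : s.card ≤ N := by
    have := card_le_capacity hs
    rw [h] at this
    exact_mod_cast this
  refine ⟨s, le_antisymm hcard' hcard, fun x => ?_⟩
  by_contra! hcon
  obtain ⟨hx, hcon⟩ := hcon
  have hd : ((insert x s : Finset X) : Set X).PairwiseDisjoint fun x => eBall e x r := by
    rw [Finset.coe_insert]
    refine hs.insert fun a ha _ => Set.disjoint_left.2 fun z hz hza => ?_
    exact (hcon a ha z hz).not_gt hza
  have h1 := card_le_capacity hd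
  rw [h, Finset.card_insert_of_notMem hx] at h1
  have h2 : s.card + 1 ≤ N := by exact_mod_cast h1
  omega

theorem le_floor_of_toENNReal_le {a : ℕ∞} {x : ℝ} (h : (a : ℝ≥0∞) ≤ ENNReal.ofReal x) :
    a ≤ (⌊x⌋₊ : ℕ∞) := by
  induction a using ENat.recTopCoe with
  | top => simp at h
  | coe k =>
    rcases eq_or_ne k 0 with rfl | hk
    · simp
    rw [ENat.toENNReal_coe, ENNReal.natCast_le_ofReal hk] at h
    exact_mod_cast Nat.le_floor h

theorem ceil_le_of_le_toENNReal {a : ℕ∞} {x : ℝ} (h : ENNReal.ofReal x ≤ (a : ℝ≥0∞)) :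
    (⌈x⌉₊ : ℕ∞) ≤ a := by
  induction a using ENat.recTopCoe with
  | top => simp
  | coe k =>
    rw [ENat.toENNReal_coe, ENNReal.ofReal_le_natCast] at h
    exact_mod_cast Nat.ceil_le.2 h

end Capacity

/-! ### Capacity of compact metric spaces and Gromov–Hausdorff distance. -/

section MetricCapacity

variable {X : Type*} [MetricSpace X]

/-- The capacity is at most the number of balls of the same radius in a cover. -/
theorem capacity_le_card_of_cover {r : ℝ} (T : Finset X)
    (hT : ∀ x : X, ∃ a ∈ T, edist x a < ENNReal.ofReal r) :
    capacity (fun x y : X => edist x y) r ≤ T.card := by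
  refine iSup₂_le fun s hs => ?_
  choose f hfT hf using hT
  have : s.card ≤ T.card := by
    refine Finset.card_le_card_of_injOn f (fun x _ => hfT x) fun x hx y hy hxy => ?_
    refine hs.elim_set hx hy (f x) (hf x) ?_
    rw [hxy]
    exact hf y
  exact_mod_cast this

theorem capacity_ne_top [CompactSpace X] {r : ℝ} (hr : 0 < r) :
    capacity (fun x y : X => edist x y) r ≠ ⊤ := by
  obtain ⟨T, hT⟩ := isCompact_univ.elim_nhds_subcover (fun z : X => Metric.ball z r)
    (fun z _ => Metric.ball_mem_nhds z hr)
  refine ne_top_of_le_ne_top (ENat.natCast_ne_top T.card) (capacity_le_card_of_cover T fun x => ?_)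
  obtain ⟨z, hz, hxz⟩ := Set.mem_iUnion₂.1 (hT.2 (Set.mem_univ x))
  exact ⟨z, hz, by rwa [edist_lt_ofReal]⟩

/-- Capacities of Gromov–Hausdorff close spaces are comparable. -/
theorem capacity_le_of_ghDist_lt {Y : Type*} [MetricSpace Y] [CompactSpace X] [CompactSpace Y]
    [Nonempty X] [Nonempty Y] {R : ℝ} (h : GromovHausdorff.ghDist X Y < R) :
    capacity (fun x y : Y => edist x y) (4 * R) ≤ capacity (fun x y : X => edist x y) R := by
  classical
  obtain ⟨Φ, Ψ, hΦ, hΨ, hd⟩ := GromovHausdorff.ghDist_eq_hausdorffDist X Y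
  have hfin : Metric.hausdorffEDist (Set.range Φ) (Set.range Ψ) ≠ ⊤ :=
    Metric.hausdorffEDist_ne_top_of_nonempty_of_bounded (Set.range_nonempty _)
      (Set.range_nonempty _) (isCompact_range hΦ.continuous).isBounded
      (isCompact_range hΨ.continuous).isBounded
  rw [hd] at h
  have hR : 0 < R := Metric.hausdorffDist_nonneg.trans_lt h
  have hex : ∀ y : Y, ∃ x : X, dist (Φ x) (Ψ y) < R := by
    intro y
    obtain ⟨_, ⟨x, rfl⟩, hx⟩ :=
      Metric.exists_dist_lt_of_hausdorffDist_lt' (Set.mem_range_self y) h hfin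
    exact ⟨x, hx⟩
  choose f hf using hex
  refine iSup₂_le fun s hs => ?_
  -- Centres of disjoint `4 R`-balls are at least `4 R` apart; moving both ends by less than `R`
  -- leaves more than `2 R`, enough for disjoint `R`-balls.
  have hfar : ∀ y ∈ s, ∀ y' ∈ s, y ≠ y' → 2 * R < dist (f y) (f y') := by
    intro y hy y' hy' hne
    have h1 : 4 * R ≤ dist y y' := by
      by_contra! hlt
      refine hne (hs.elim_set hy hy' y' ?_ ?_)
      · rw [eBall, Set.mem_ofPred_eq, edist_lt_ofReal]
        exact hlt
      · rw [eBall, Set.mem_ofPred_eq, edist_self, ENNReal.ofReal_pos]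
        positivity
    have h2 : dist y y' ≤ dist (Φ (f y)) (Ψ y) + dist (Φ (f y)) (Φ (f y')) +
        dist (Φ (f y')) (Ψ y') := by
      rw [← hΨ.dist_eq, dist_comm (Φ (f y)) (Ψ y)]
      exact dist_triangle4 _ _ _ _
    rw [hΦ.dist_eq] at h2
    linarith [hf y, hf y']
  have hinj : Set.InjOn f s := by
    intro y hy y' hy' heq
    by_contra hne
    have := hfar y hy y' hy' hne
    rw [heq, dist_self] at this
    linarith
  rw [← Finset.card_image_of_injOn hinj]
  refine card_le_capacity ?_
  rw [Finset.coe_image]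
  rintro _ ⟨y, hy, rfl⟩ _ ⟨y', hy', rfl⟩ hne
  refine Set.disjoint_left.2 fun z hz hz' => ?_
  simp only [eBall, Set.mem_ofPred_eq, edist_lt_ofReal] at hz hz'
  have h1 := hfar y hy y' hy' fun h => hne (by rw [h])
  have h2 := dist_triangle_right (f y) (f y') z
  linarith

end MetricCapacity

namespace Foliation

/-! ### Capacity of `M` against those of the leaves and of the space of leaves. -/

section LeafSpaceCapacity

variable {p n : ℕ} {M : Type*} [MetricSpace M] [ChartedSpace (Euc n) M]
  (F : Foliation p n M)

theorem setDist_comm (L L' : F.LeafSpace) : F.setDist L L' = F.setDist L' L := by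
  have key : ∀ L L' : F.LeafSpace, F.setDist L L' ≤ F.setDist L' L := fun L L' =>
    le_iInf₂ fun x y => le_iInf₂ fun hx hy =>
      (iInf₂_le_of_le y x (iInf₂_le_of_le hy hx (edist_comm y x).le))
  exact le_antisymm (key _ _) (key _ _)

theorem rho_comm (L L' : F.LeafSpace) : F.rho L L' = F.rho L' L := by
  have key : ∀ L L' : F.LeafSpace, F.rho L L' ≤ F.rho L' L := by
    intro L L'
    refine le_iInf₂ fun m S => le_iInf₂ fun h0 hm => ?_
    refine iInf₂_le_of_le m (fun i => S (m - i)) (iInf₂_le_of_le (by simpa using hm)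
      (by simpa using h0) (le_of_eq ?_))
    rw [← Finset.sum_range_reflect (fun i => F.setDist (S i) (S (i + 1)))]
    refine Finset.sum_congr rfl fun i hi => ?_
    have hi' := Finset.mem_range.1 hi
    beta_reduce
    rw [setDist_comm, show m - (i + 1) = m - 1 - i by omega, show m - i = m - 1 - i + 1 by omega]
  exact le_antisymm (key _ _) (key _ _)

theorem rho_mk_le (x y : M) : F.rho ⟦x⟧ ⟦y⟧ ≤ edist x y := by
  refine iInf₂_le_of_le 1 (fun i => if i = 0 then ⟦x⟧ else ⟦y⟧)
    (iInf₂_le_of_le (by simp) (by simp) ?_)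
  simp only [Finset.sum_range_one, if_true]
  exact iInf₂_le_of_le x y (iInf₂_le_of_le rfl (by simp) le_rfl)

/-- Leaves whose `ρ`-balls are disjoint have disjoint neighbourhoods. -/
theorem disjoint_eBall_of_disjoint_rho {x y : M} {r : ℝ}
    (h : Disjoint (eBall F.rho ⟦x⟧ r) (eBall F.rho ⟦y⟧ r)) :
    Disjoint (eBall edist x r) (eBall edist y r) :=
  Set.disjoint_left.2 fun z hx hy => Set.disjoint_left.1 h
    (show (⟦z⟧ : F.LeafSpace) ∈ eBall F.rho ⟦x⟧ r from (F.rho_mk_le x z).trans_lt hx)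
    (show (⟦z⟧ : F.LeafSpace) ∈ eBall F.rho ⟦y⟧ r from (F.rho_mk_le y z).trans_lt hy)

/-- One point per leaf suffices, as the projection to the space of leaves is 1-Lipschitz. For
compact `M` this makes `Cap_r(M/F)` finite. -/
theorem capacity_rho_le (r : ℝ) : capacity F.rho r ≤ capacity (fun x y : M => edist x y) r := by
  classical
  refine iSup₂_le fun s hs => ?_
  rw [← Finset.card_image_of_injective s Quotient.out_injective]
  refine card_le_capacity ?_
  rw [Finset.coe_image]
  rintro _ ⟨L, hL, rfl⟩ _ ⟨L', hL', rfl⟩ hne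
  refine F.disjoint_eBall_of_disjoint_rho ?_
  rw [Quotient.out_eq, Quotient.out_eq]
  exact hs hL hL' fun h => hne (by rw [h])

/-- Lower bound for the capacity of `M` by the capacities of the space of leaves and of the
leaves. -/
theorem mul_le_capacity [RiemannianBundle (fun x : M => TangentSpace (𝓡 n) x)] {r : ℝ} {N m : ℕ}
    (hdisj : ∀ x : M, ∀ a b : F.leaf x,
      Disjoint (eBall (F.edistOnLeaf x) a r) (eBall (F.edistOnLeaf x) b r) →
        Disjoint (eBall edist (a : M) r) (eBall edist (b : M) r))
    (hN : (N : ℕ∞) ≤ capacity F.rho r)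
    (hm : ∀ x : M, (m : ℕ∞) ≤ capacity (F.edistOnLeaf x) r) :
    ((N * m : ℕ) : ℕ∞) ≤ capacity (fun x y : M => edist x y) r := by
  classical
  obtain ⟨s, hs, hsN⟩ := exists_card_ge_of_le_capacity hN
  choose t ht htm using fun x : M => exists_card_ge_of_le_capacity (hm x)
  let T : F.LeafSpace → Finset M := fun L => (t L.out).map (Function.Embedding.subtype _)
  have hT : ∀ L, ∀ x ∈ T L, (⟦x⟧ : F.LeafSpace) = L := by
    intro L x hx
    obtain ⟨a, _, rfl⟩ := Finset.mem_map.1 hx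
    have h1 := F.mk_eq_mk_iff_mem.2 a.2
    rw [Quotient.out_eq] at h1
    exact h1.symm
  have hcard : N * m ≤ (s.biUnion T).card := by
    rw [Finset.card_biUnion fun L _ L' _ hne => Finset.disjoint_left.2 fun x hx hx' =>
      hne ((hT L x hx).symm.trans (hT L' x hx'))]
    calc N * m ≤ s.card * m := Nat.mul_le_mul_right _ hsN
      _ = s.card • m := (smul_eq_mul _ _).symm
      _ ≤ _ := Finset.card_nsmul_le_sum _ _ _ fun L _ => by
        rw [Finset.card_map]
        exact htm _
  refine le_trans (by exact_mod_cast hcard) (card_le_capacity (s := s.biUnion T) ?_)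
  intro x hx y hy hne
  obtain ⟨L, hL, hxL⟩ := Finset.mem_biUnion.1 hx
  obtain ⟨L', hL', hyL'⟩ := Finset.mem_biUnion.1 hy
  by_cases hLL : L = L'
  · subst hLL
    obtain ⟨a, ha, rfl⟩ := Finset.mem_map.1 hxL
    obtain ⟨b, hb, rfl⟩ := Finset.mem_map.1 hyL'
    exact hdisj _ a b (ht _ ha hb fun h => hne (by rw [h]))
  · refine F.disjoint_eBall_of_disjoint_rho ?_
    rw [hT L x hxL, hT L' y hyL']
    exact hs hL hL' hLL

variable {F} [RiemannianBundle (fun x : M => TangentSpace (𝓡 n) x)]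
  [IsRiemannianManifold (𝓡 n) M]

theorem edist_le_edistOnLeaf (x : M) (a b : F.leaf x) :
    edist (a : M) b ≤ F.edistOnLeaf x a b := by
  refine le_iInf₂ fun γ hγ => le_iInf₂ fun h0 h1 => le_iInf fun _ => ?_
  have h2 := edist_le_pathELength hγ (t := 1) ⟨zero_le_one, le_rfl⟩
  rwa [h0, h1] at h2

variable [IsManifold (𝓡 n) ∞ M] [CompactSpace M]

/-- Upper bound for the capacity of `M` by the capacities of the space of leaves and of the
leaves. -/
theorem IsComparablyRiemannian.capacity_le_mul {C : ℝ} (hF : F.IsComparablyRiemannian C)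
    (hC : 1 ≤ C) {r : ℝ} (hr : 0 < r) {N K : ℕ} (hN : capacity F.rho r = N)
    (hK : ∀ x : M, capacity (F.edistOnLeaf x) r ≤ K) :
    capacity (fun x y : M => edist x y) (6 * C * r) ≤ ((N * K : ℕ) : ℕ∞) := by
  classical
  obtain ⟨s, hsN, hs⟩ := exists_maximal_family hN
  have hleaf : ∀ x : M, ∃ t : Finset M, t.card ≤ K ∧ ∀ y ∈ F.leaf x, ∃ a ∈ t,
      edist y a < ENNReal.ofReal (2 * r) := by
    intro x
    obtain ⟨k, hk⟩ := ENat.ne_top_iff_exists.1 (ne_top_of_le_ne_top (ENat.natCast_ne_top K) (hK x))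
    obtain ⟨t, htk, ht⟩ := exists_maximal_family hk.symm
    refine ⟨t.map (Function.Embedding.subtype _), ?_, fun y hy => ?_⟩
    · rw [Finset.card_map, htk]
      have := hK x
      rw [← hk] at this
      exact_mod_cast this
    · rcases ht ⟨y, hy⟩ with h | ⟨a, ha, z, h1, h2⟩
      · refine ⟨y, Finset.mem_map.2 ⟨_, h, rfl⟩, ?_⟩
        rw [edist_self, ENNReal.ofReal_pos]
        positivity
      · refine ⟨a, Finset.mem_map.2 ⟨a, ha, rfl⟩, ?_⟩
        calc edist y (a : M) ≤ edist y (z : M) + edist (a : M) z := edist_triangle_right _ _ _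
          _ < ENNReal.ofReal r + ENNReal.ofReal r := ENNReal.add_lt_add
              ((edist_le_edistOnLeaf x ⟨y, hy⟩ z).trans_lt h1)
              ((edist_le_edistOnLeaf x a z).trans_lt h2)
          _ = ENNReal.ofReal (2 * r) := by
              rw [← ENNReal.ofReal_add hr.le hr.le, two_mul]
  choose t htK ht using hleaf
  have hcover : ∀ x : M, ∃ a ∈ s.biUnion fun L => t L.out,
      edist x a < ENNReal.ofReal (6 * C * r) := by
    intro x
    obtain ⟨L, hL, x', hx', hxx'⟩ : ∃ L ∈ s, ∃ x' : M, (⟦x'⟧ : F.LeafSpace) = L ∧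
        edist x x' ≤ ENNReal.ofReal (4 * C * r) := by
      -- By maximality some leaf `L'` is `r`-close both to the leaf of `x` and to a chosen leaf `L`.
      -- Going from `x` to `L'` and on to `L` costs `2 C r` twice.
      rcases hs ⟦x⟧ with h | ⟨L, hL, L', h1, h2⟩
      · exact ⟨_, h, x, rfl, by simp⟩
      · obtain ⟨y, hy, hxy⟩ := hF.exists_edist_le_of_rho_lt hC h1 rfl
        rw [rho_comm] at h2
        obtain ⟨x', hx', hyx'⟩ := hF.exists_edist_le_of_rho_lt hC h2 hy
        refine ⟨L, hL, x', hx', (edist_triangle x y x').trans ((add_le_add hxy hyx').trans ?_)⟩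
        rw [← ENNReal.ofReal_mul (by positivity), ← ENNReal.ofReal_add (by positivity)
          (by positivity)]
        exact ENNReal.ofReal_le_ofReal (by linarith)
    have hx'L : x' ∈ F.leaf L.out := by
      rw [← mk_eq_mk_iff_mem, Quotient.out_eq, hx']
    obtain ⟨a, ha, hxa⟩ := ht L.out x' hx'L
    refine ⟨a, Finset.mem_biUnion.2 ⟨L, hL, ha⟩, (edist_triangle x x' a).trans_lt ?_⟩
    refine (ENNReal.add_lt_add_of_le_of_lt (ne_top_of_le_ne_top ENNReal.ofReal_ne_top hxx')
      hxx' hxa).trans_le ?_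
    rw [← ENNReal.ofReal_add (by positivity) (by positivity)]
    -- `4 C r` to reach `L` and `2 r` along it; `C ≥ 1` gives the bound `6 C r`.
    exact ENNReal.ofReal_le_ofReal (by nlinarith)
  refine (capacity_le_card_of_cover _ hcover).trans ?_
  have : (s.biUnion fun L => t L.out).card ≤ N * K := by
    rw [← hsN]
    exact Finset.card_biUnion_le_card_mul _ _ _ fun L _ => htK _
  exact_mod_cast this

end LeafSpaceCapacity

end Foliation

/-! ### Separation -/

/-- Comparison of the capacities at two scales under a two-sided capacity estimate. -/
theorem CapacityEstimate.capacity_le {X : Type*} {e : X → X → ℝ≥0∞} {k : ℕ} {V : ℝ≥0∞} {c θ : ℝ}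
    (h : CapacityEstimate e k V c θ) (hc : 0 < c) {r s : ℝ} (hr : 0 < r) (hrθ : r < θ)
    (hs : 0 < s) (hsθ : s < θ) :
    (capacity e r : ℝ≥0∞) ≤ ENNReal.ofReal (c ^ 2 * (s / r) ^ k) * (capacity e s : ℝ≥0∞) := by
  have h1 := (h r hr hrθ).2
  have h2 := (h s hs hsθ).1
  calc (capacity e r : ℝ≥0∞) ≤ ENNReal.ofReal (c / r ^ k) * V := h1
    -- The same `V` occurs in both estimates, so no bound on the volume is needed.
    _ = ENNReal.ofReal (c ^ 2 * (s / r) ^ k) * (ENNReal.ofReal (1 / (c * s ^ k)) * V) := by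
      rw [← mul_assoc, ← ENNReal.ofReal_mul (by positivity)]
      congr 2
      rw [div_pow]
      field_simp
    _ ≤ _ := by gcongr

namespace Foliation.InClass

variable {p n : ℕ} {M : Type*} [MetricSpace M] [ChartedSpace (Euc n) M]
    [IsManifold (𝓡 n) ∞ M] [RiemannianBundle (fun x : M => TangentSpace (𝓡 n) x)]
    {F : Foliation p n M} {d C : ℝ}

/-- Leaf volumes lie between `1 / C` and `C`, so leaf capacities are of order `r ^ (-p)` uniformly
over the leaves; this is the upper half. -/
theorem capacity_leaf_le (h : F.InClass d C) {r : ℝ} (hr : 0 < r) (hrC : r < 1 / C) (x : M) :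
    _root_.capacity (F.edistOnLeaf x) r ≤ (⌊C ^ 2 / r ^ p⌋₊ : ℕ∞) := by
  obtain ⟨c, θ, hc1, hcC, hθ, hest⟩ := h.leaf_capacity x
  refine le_floor_of_toENNReal_le ((hest r hr (hrC.trans_le hθ)).2.trans ?_)
  calc ENNReal.ofReal (c / r ^ p) * F.leafVolume x
      ≤ ENNReal.ofReal (c / r ^ p) * ENNReal.ofReal C := by
        gcongr
        exact (h.leaf_volume x).2
    _ = ENNReal.ofReal (c / r ^ p * C) := (ENNReal.ofReal_mul (by positivity)).symm
    _ ≤ ENNReal.ofReal (C ^ 2 / r ^ p) := by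
        refine ENNReal.ofReal_le_ofReal ?_
        rw [div_mul_eq_mul_div, sq]
        gcongr
        linarith

theorem le_capacity_leaf (h : F.InClass d C) {r : ℝ} (hr : 0 < r) (hrC : r < 1 / C) (x : M) :
    (⌈1 / (C ^ 2 * r ^ p)⌉₊ : ℕ∞) ≤ _root_.capacity (F.edistOnLeaf x) r := by
  obtain ⟨c, θ, hc1, hcC, hθ, hest⟩ := h.leaf_capacity x
  have hC : 0 < C := by linarith
  refine ceil_le_of_le_toENNReal (le_trans ?_ (hest r hr (hrC.trans_le hθ)).1)
  calc ENNReal.ofReal (1 / (C ^ 2 * r ^ p)) ≤ ENNReal.ofReal (1 / (c * r ^ p) * (1 / C)) := by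
        refine ENNReal.ofReal_le_ofReal ?_
        rw [one_div_mul_one_div]
        refine one_div_le_one_div_of_le (by positivity) ?_
        calc c * r ^ p * C ≤ C * r ^ p * C := by gcongr
          _ = C ^ 2 * r ^ p := by ring
    _ = ENNReal.ofReal (1 / (c * r ^ p)) * ENNReal.ofReal (1 / C) :=
        ENNReal.ofReal_mul (by positivity)
    _ ≤ _ := by
        gcongr
        exact (h.leaf_volume x).1

/-- If `M` and `M'` are Gromov–Hausdorff close at a small scale `r`, then `r` is not too small. -/
theorem pow_le_of_ghDist_le [IsRiemannianManifold (𝓡 n) M] [CompactSpace M] [Nonempty M]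
    {p' n' : ℕ} {M' : Type*} [MetricSpace M'] [CompactSpace M'] [Nonempty M']
    [ChartedSpace (Euc n') M'] [IsManifold (𝓡 n') ∞ M']
    [RiemannianBundle (fun x : M' => TangentSpace (𝓡 n') x)] {F' : Foliation p' n' M'}
    (hF : F.InClass d C) (hF' : F'.InClass d C) (hb : Broader F'.rho F.rho) (hC : 1 ≤ C) {r : ℝ}
    (hr : 0 < r) (hrd : r < d) (hrC : 24 * C * r < 1 / C)
    (hgh : GromovHausdorff.ghDist M M' ≤ r) :
    r ^ p ≤ C ^ 6 * (24 * C) ^ n' * r ^ p' := by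
  have hC0 : 0 < C := by linarith
  have hrC' : r < 1 / C := by nlinarith
  obtain ⟨N, hN⟩ := ENat.ne_top_iff_exists.1
    (ne_top_of_le_ne_top (capacity_ne_top hr) (F.capacity_rho_le r))
  -- A single ball is a disjoint family; `N` is to be cancelled below.
  have hN1 : 0 < N := by
    have h1 : (({⟦Classical.arbitrary M⟧} : Finset F.LeafSpace).card : ℕ∞) ≤
        _root_.capacity F.rho r := card_le_capacity (by simp)
    rw [← hN, Finset.card_singleton] at h1
    exact_mod_cast h1
  set K := ⌊C ^ 2 / r ^ p⌋₊ with hK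
  set m := ⌈1 / (C ^ 2 * r ^ p')⌉₊ with hm
  have hup := IsComparablyRiemannian.capacity_le_mul hF.exists_riemannian hC hr hN.symm
    (hF.capacity_leaf_le hr hrC')
  have hlow := F'.mul_le_capacity (fun x a b => hF'.disjoint_balls x a b r hrd)
    (hN.le.trans (hb r hr)) (hF'.le_capacity_leaf hr hrC')
  have hghc := capacity_le_of_ghDist_lt (X := M) (Y := M') (R := 6 * C * r) (by nlinarith)
  obtain ⟨c, θ, hc1, hcC, hθ, hest⟩ := hF'.capacity
  -- Returning from the scale `24 C r`, produced by the two preceding comparisons, to `r` costs `c ^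
  -- 2 (24 C) ^ n'`.
  have hscale := hest.capacity_le (by linarith) hr (hrC'.trans_le hθ)
    (s := 4 * (6 * C * r)) (by positivity) (by linarith)
  have hchain : ((N * m : ℕ) : ℝ) ≤ c ^ 2 * (4 * (6 * C * r) / r) ^ n' * ((N * K : ℕ) : ℝ) := by
    have h1 : (((N * m : ℕ) : ℕ∞) : ℝ≥0∞) ≤
        ENNReal.ofReal (c ^ 2 * (4 * (6 * C * r) / r) ^ n') * (((N * K : ℕ) : ℕ∞) : ℝ≥0∞) :=
      (ENat.toENNReal_le.2 hlow).trans (hscale.trans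
        (by gcongr; exact hghc.trans hup))
    rw [ENat.toENNReal_coe, ENat.toENNReal_coe, ← ENNReal.ofReal_natCast,
      ← ENNReal.ofReal_natCast (N * K), ← ENNReal.ofReal_mul (by positivity)] at h1
    exact (ENNReal.ofReal_le_ofReal_iff (by positivity)).1 h1
  have hN0 : (0 : ℝ) < N := by exact_mod_cast hN1
  have h24 : 4 * (6 * C * r) / r = 24 * C := by field_simp; ring
  rw [h24] at hchain
  push_cast at hchain
  have hmK : (m : ℝ) ≤ c ^ 2 * (24 * C) ^ n' * K := by
    refine le_of_mul_le_mul_left ?_ hN0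
    linarith
  have hm' : 1 / (C ^ 2 * r ^ p') ≤ m := Nat.le_ceil _
  have hK' : (K : ℝ) ≤ C ^ 2 / r ^ p := Nat.floor_le (by positivity)
  have hfin : 1 / (C ^ 2 * r ^ p') ≤ C ^ 2 * (24 * C) ^ n' * (C ^ 2 / r ^ p) := by
    refine hm'.trans (hmK.trans ?_)
    gcongr
  rw [← mul_div_assoc, div_le_div_iff₀ (by positivity) (by positivity)] at hfin
  calc r ^ p = 1 * r ^ p := (one_mul _).symm
    _ ≤ _ := hfin
    _ = _ := by ring

end Foliation.InClass

end

universe u v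

theorem theorem4p1 (d C : ℝ) (hd : 0 < d) (hC : 1 ≤ C) (p p' n n' : ℕ) (hp : p < p')
    (hn : n ≤ n') :
    ∃ ε : ℝ, 0 < ε ∧
      ∀ (M : Type u) [MetricSpace M] [CompactSpace M] [ConnectedSpace M]
        [ChartedSpace (Euc n) M] [IsManifold (𝓡 n) ∞ M]
        [RiemannianBundle (fun x : M => TangentSpace (𝓡 n) x)]
        [IsContMDiffRiemannianBundle (𝓡 n) ∞ (Euc n) (fun x : M => TangentSpace (𝓡 n) x)]
        [IsRiemannianManifold (𝓡 n) M]
        (F : Foliation p n M)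
        (M' : Type v) [MetricSpace M'] [CompactSpace M'] [ConnectedSpace M']
        [ChartedSpace (Euc n') M'] [IsManifold (𝓡 n') ∞ M']
        [RiemannianBundle (fun x : M' => TangentSpace (𝓡 n') x)]
        [IsContMDiffRiemannianBundle (𝓡 n') ∞ (Euc n') (fun x : M' => TangentSpace (𝓡 n') x)]
        [IsRiemannianManifold (𝓡 n') M']
        (F' : Foliation p' n' M'),
        F.InClass d C → F'.InClass d C → Broader F'.rho F.rho →
          ε < GromovHausdorff.ghDist M M' := by
  have hC0 : 0 < C := by linarith
  set D : ℝ := C ^ 6 * (24 * C) ^ n' with hD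
  have hDpos : 0 < D := by positivity
  -- `r < d` allows the axiom on disjoint balls, `24 C r < 1 / C` keeps all scales in the range of
  -- the capacity estimates, `r < 1` gives `r ^ p' ≤ r ^ (p + 1)`, and `D r < 1` yields the
  -- contradiction.
  obtain ⟨r, hr, hrd, hr1, hrC, hrD⟩ : ∃ r : ℝ, 0 < r ∧ r < d ∧ r < 1 ∧ r < 1 / C / (24 * C) ∧
      r < 1 / D := by
    have hpos : 0 < min (min d 1) (min (1 / C / (24 * C)) (1 / D)) := by positivity
    obtain ⟨r, hr, hlt⟩ := exists_between hpos
    simp only [lt_min_iff] at hlt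
    exact ⟨r, hr, hlt.1.1, hlt.1.2, hlt.2.1, hlt.2.2⟩
  refine ⟨r, hr, ?_⟩
  intro M _ _ _ _ _ _ _ _ F M' _ _ _ _ _ _ _ _ F' hF hF' hb
  by_contra! hgh
  have key := hF.pow_le_of_ghDist_le hF' hb hC hr hrd
    (by rwa [lt_div_iff₀' (by positivity)] at hrC) hgh
  have h1 : r ^ p' ≤ r ^ (p + 1) := pow_le_pow_of_le_one hr.le hr1.le hp
  have h2 : r ^ p * 1 ≤ r ^ p * (D * r) := by
    calc r ^ p * 1 ≤ D * r ^ p' := by rw [mul_one]; exact key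
      _ ≤ D * r ^ (p + 1) := by gcongr
      _ = _ := by ring
  have h3 := le_of_mul_le_mul_left h2 (by positivity)
  rw [lt_div_iff₀' hDpos] at hrD
  linarith
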